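/- Let $q\ge 2$, $\epsilon=(-1)^q$, and let $\Lambda$ be a weakly finite ring with $1$ and involution $a\mapsto\bar a$ (weakly finite: $\Lambda^n\oplus K\cong\Lambda^n$ implies $K=0$). Modules are left $\Lambda$-modules; $M^*=\mathrm{Hom}_\Lambda(M,\Lambda)$ is a left module through the involution, and $M=M^{**}$ for $M$ f.g. free. For a sign $\delta$ put $Q_\delta(M)=\mathrm{coker}\big(1-T_\delta:\mathrm{Hom}(M,M^*)\to\mathrm{Hom}(M,M^*)\big)$, $T_\delta\varphi=\delta\varphi^*$. **Definitions.** A *regular $\epsilon$-quadratic split preformation* $z=(F\xleftarrow{\gamma}(G,\theta)\xrightarrow{\mu}F^*)$ consists of f.g. free modules $F,G$, homomorphisms $\gamma,\mu$ and $\theta\in Q_{-\epsilon}(G)$ with $\gamma^*\mu=\theta-\epsilon\theta^*$. It is a *non-singular split formation* if $\binom{\gamma}{\mu}:G\to F\oplus F^*$ is the inclusion of a lagrangian of the hyperbolic $\epsilon$-quadratic form $H_\epsilon(F)=\big(F\oplus F^*,\begin{pmatrix}0&1\\0&0\end{pmatrix}\big)$, i.e. it is injective with image a direct summand on which the quadratic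 form vanishes and which equals its own annihilator. A *flip-isomorphism* of $z$ is a triple $t=(\alpha,\beta,\nu)$ of isomorphisms $\alpha:F\to F^*$, $\beta:G\to G$ and $\nu\in Q_{-\epsilon}(F^*)$ with $$\alpha\gamma+\alpha(\nu-\epsilon\nu^*)^*\mu=\epsilon\mu\beta,\qquad \alpha^{-*}\mu=\gamma\beta,\qquad \theta+\mu^*\nu\mu+\beta^*\theta\beta=0\in Q_{-\epsilon}(G).$$ The *boundary* of a $(-\epsilon)$-quadratic form $(K,\theta)$ on a f.g. free module is $\partial(K,\theta)=(K\xleftarrow{1}(K,\theta)\xrightarrow{\theta-\epsilon\theta^*}K^*)$. A *stable flip-isomorphism* of $z$ is a flip-isomorphism of $z+h$, where $h=\partial H_{-\epsilon}(L)$ for some f.g. free $L$. A *strong isomorphism* $z\to z'$ is a pair $(\eta,\zeta)$ of isomorphisms $\eta:F\to F'$, $\zeta:G\to G'$ with $\eta\gamma=\gamma'\zeta$, $\eta^{-*}\mu=\mu'\zeta$, $\theta=\zeta^*\theta'\zeta$. The abelian monoid $l_{2q+2}(\Lambda)$ is the set of regular $\epsilon$-quadratic split preformations up to strong isomorphism and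 addition of boundaries $\partial H_{-\epsilon}(L)$. The abelian monoid $fl_{2q+2}(\Lambda)$ is the set of pairs $(z,t)$ (with $z$ a regular split preformation, $t=(\alpha,\beta,\nu)$ a flip-isomorphism of $z$) up to isomorphism (a strong isomorphism $(\eta,\zeta)$ with $\alpha'=\eta^{-*}\alpha\eta^{-1}$, $\beta'=\zeta\beta\zeta^{-1}$, $\nu'=\eta\nu\eta^*$) and addition of pairs $(y^k,t^k)$, where $y^k=\partial H_{-\epsilon}(\Lambda^k)$ and $t^k=\left(\begin{pmatrix}0&-\epsilon\\-1&0\end{pmatrix},\begin{pmatrix}1&0\\0&-1\end{pmatrix},0\right)$. Let $\pi:fl_{2q+2}(\Lambda)\to l_{2q+2}(\Lambda)$, $[(z,t)]\mapsto[z]$. The asymmetric Witt group $LAsy^0(\Lambda)$ consists of the non-singular asymmetric forms $(M,\lambda)$ ($M$ f.g. free, $\lambda:M\to M^*$ an isomorphism) up to isomorphism and addition of non-singular metabolic forms; $(M,\lambda)$ is metabolic if there is a direct summand $L\subset M$ with $L=\{x\in M:\lambda(x)(L)=0\}$. The *asymmetric signature* of a flip-isomorphism $t=(\alpha,\beta,\nu)$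 of $z$ is the class $\sigma^*(z,t)\in LAsy^0(\Lambda)$ of the non-singular asymmetric form $$\rho=\begin{pmatrix}0&0&\alpha\\1&0&-\epsilon\\0&1&\epsilon\alpha(\nu^*-\epsilon\nu)\alpha^*\end{pmatrix}:F\oplus F^*\oplus F\to(F\oplus F^*\oplus F)^*.$$ It gives a monoid homomorphism $\sigma^*:fl_{2q+2}(\Lambda)\to LAsy^0(\Lambda)$, $[(z,t)]\mapsto\sigma^*(z,t)$. **Theorem.** Let $z$ be a non-singular $\epsilon$-quadratic split formation, and let $t$ and $t'$ be two flip-isomorphisms of $z$. Then $\sigma^*(z,t)=\sigma^*(z,t')\in LAsy^0(\Lambda)$. Hence, with $$\tilde l_{2q+2}(\Lambda)=\{[z]\in l_{2q+2}(\Lambda): z\text{ a non-singular }\epsilon\text{-quadratic split formation which allows a stable flip-isomorphism}\},$$ $\tilde l_{2q+2}(\Lambda)$ is a submonoid of $l_{2q+2}(\Lambda)$, and $\sigma^*$ induces a map on it: there is a unique monoid homomorphism $\tilde\sigma^*:\tilde l_{2q+2}(\Lambda)\to LAsy^0(\Lambda)$ such that $\tilde\sigma^*(\pi(x))=\sigma^*(x)$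 for all $x\in fl_{2q+2}(\Lambda)$ with $\pi(x)\in\tilde l_{2q+2}(\Lambda)$. -/

import Mathlib

universe u v

set_option linter.unusedSectionVars false

namespace Preform

section Duality

variable {Λ : Type u} [Ring Λ] [StarRing Λ]

/-- The dual `M* = Hom_Λ(M, Λ)` of a left `Λ`-module, again a left `Λ`-module through the
involution of `Λ`: `(a • f) x = f x * star a`. -/
def SDual (Λ : Type u) [Ring Λ] (M : Type v) [AddCommGroup M] [Module Λ M] : Type (max u v) :=
  M →ₗ[Λ] Λ

section

variable {M : Type v} [AddCommGroup M] [Module Λ M]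

instance : AddCommGroup (SDual Λ M) := inferInstanceAs (AddCommGroup (M →ₗ[Λ] Λ))

instance : FunLike (SDual Λ M) M Λ := inferInstanceAs (FunLike (M →ₗ[Λ] Λ) M Λ)

instance : LinearMapClass (SDual Λ M) Λ M Λ :=
  inferInstanceAs (LinearMapClass (M →ₗ[Λ] Λ) Λ M Λ)

/-- A linear functional, seen as an element of the dual. -/
def SDual.of (f : M →ₗ[Λ] Λ) : SDual Λ M := f

@[simp] theorem SDual.of_apply (f : M →ₗ[Λ] Λ) (x : M) : SDual.of f x = f x := rfl

@[ext] theorem SDual.ext {f g : SDual Λ M} (h : ∀ x, f x = g x) : f = g := DFunLike.ext _ _ h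

@[simp] theorem SDual.add_apply (f g : SDual Λ M) (x : M) : (f + g) x = f x + g x := rfl
@[simp] theorem SDual.neg_apply (f : SDual Λ M) (x : M) : (-f) x = -f x := rfl
@[simp] theorem SDual.sub_apply (f g : SDual Λ M) (x : M) : (f - g) x = f x - g x := rfl
@[simp] theorem SDual.zero_apply (x : M) : (0 : SDual Λ M) x = 0 := rfl

theorem SDual.sum_apply {ι : Type*} (s : Finset ι) (f : ι → SDual Λ M) (x : M) :
    (∑ i ∈ s, f i) x = ∑ i ∈ s, f i x :=
  map_sum (⟨⟨fun g => g x, rfl⟩, fun _ _ => rfl⟩ : SDual Λ M →+ Λ) f s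

instance : Module Λ (SDual Λ M) where
  smul a f := SDual.of
    { toFun := fun x => f x * star a
      map_add' := fun x y => by rw [map_add, add_mul]
      map_smul' := fun c x => by rw [map_smul, smul_eq_mul, mul_assoc]; rfl }
  one_smul f := SDual.ext fun x => show f x * star 1 = f x by simp
  mul_smul a b f := SDual.ext fun x =>
    show f x * star (a * b) = f x * star b * star a by rw [star_mul, mul_assoc]
  smul_zero a := SDual.ext fun x => show (0 : Λ) * star a = 0 by simp
  smul_add a f g := SDual.ext fun x =>
    show (f x + g x) * star a = f x * star a + g x * star a by rw [add_mul]
  add_smul a b f := SDual.ext fun x =>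
    show f x * star (a + b) = f x * star a + f x * star b by rw [star_add, mul_add]
  zero_smul f := SDual.ext fun x => show f x * star 0 = 0 by simp

@[simp] theorem SDual.smul_apply (a : Λ) (f : SDual Λ M) (x : M) : (a • f) x = f x * star a := rfl

end

variable {M : Type u} [AddCommGroup M] [Module Λ M] {N : Type u} [AddCommGroup N] [Module Λ N]
  {P : Type u} [AddCommGroup P] [Module Λ P]

@[simp] theorem SDual.units_smul_apply (ε : ℤˣ) (f : SDual Λ M) (x : M) :
    (ε • f) x = ε • f x := by
  rcases Int.units_eq_one_or ε with rfl | rfl <;> simp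

theorem star_units_smul (ε : ℤˣ) (a : Λ) : star (ε • a) = ε • star a := by
  rcases Int.units_eq_one_or ε with rfl | rfl <;> simp

theorem lm_units_smul_apply (ε : ℤˣ) (f : M →ₗ[Λ] N) (x : M) : (ε • f) x = ε • f x := rfl

theorem units_smul_self (ε : ℤˣ) (x : M) : ε • ε • x = x := by
  rcases Int.units_eq_one_or ε with rfl | rfl <;> simp

/-- The dual `f* : N* → M*` of a linear map `f : M → N`. -/
def dualMap (f : M →ₗ[Λ] N) : SDual Λ N →ₗ[Λ] SDual Λ M where
  toFun g := SDual.of ((show N →ₗ[Λ] Λ from g).comp f)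
  map_add' _ _ := rfl
  map_smul' _ _ := rfl

@[simp] theorem dualMap_apply (f : M →ₗ[Λ] N) (g : SDual Λ N) (x : M) :
    dualMap f g x = g (f x) := rfl

/-- The dual `φ* : N → M*`, `φ* y x = star (φ x y)`, of a linear map `φ : M → N*`
(that is, the composition of `N → N**` with the dual map `N** → M*`). -/
def adj (φ : M →ₗ[Λ] SDual Λ N) : N →ₗ[Λ] SDual Λ M where
  toFun y := SDual.of
    { toFun := fun x => star (φ x y)
      map_add' := fun x x' => by simp
      map_smul' := fun c x => by simp }
  map_add' y y' := SDual.ext fun x => by simp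
  map_smul' c y := SDual.ext fun x => by simp

@[simp] theorem adj_apply (φ : M →ₗ[Λ] SDual Λ N) (y : N) (x : M) :
    adj φ y x = star (φ x y) := rfl

/-- The canonical map `M → M**`, `x ↦ (f ↦ star (f x))`. -/
def ev : M →ₗ[Λ] SDual Λ (SDual Λ M) := adj LinearMap.id

@[simp] theorem ev_apply (x : M) (f : SDual Λ M) : ev (Λ := Λ) x f = star (f x) := rfl

/-- A basis of `M` gives coordinates on `M*`. -/
noncomputable def dualCoord {ι : Type v} (b : Module.Basis ι Λ M) : SDual Λ M ≃ₗ[Λ] (ι → Λ) where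
  toFun f i := star (f (b i))
  map_add' f g := by ext i; simp
  map_smul' c f := by ext i; simp
  invFun c := SDual.of (b.constr ℕ (fun i => star (c i)))
  left_inv f := by
    have : b.constr ℕ (fun i => star (star (f (b i)))) = (show M →ₗ[Λ] Λ from f) := by
      apply b.ext
      intro i
      rw [b.constr_basis, star_star]
      rfl
    exact this
  right_inv c := by ext i; simp

section Free

variable [Module.Free Λ M] [Module.Finite Λ M]

instance : Module.Free Λ (SDual Λ M) := by
  let b := Module.Free.chooseBasis Λ M
  exact Module.Free.of_equiv (dualCoord b).symm

instance : Module.Finite Λ (SDual Λ M) := by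
  let b := Module.Free.chooseBasis Λ M
  exact Module.Finite.equiv (dualCoord b).symm

theorem ev_bijective : Function.Bijective (ev (Λ := Λ) (M := M)) := by
  classical
  let b := Module.Free.chooseBasis Λ M
  constructor
  · rw [injective_iff_map_eq_zero]
    intro x hx
    apply b.ext_elem
    intro i
    have := congrArg (fun F : SDual Λ (SDual Λ M) => F (SDual.of (b.coord i))) hx
    simpa using this
  · intro Φ
    refine ⟨∑ i, star (Φ (SDual.of (b.coord i))) • b i, ?_⟩
    ext f
    have hf : f = ∑ i, star (f (b i)) • SDual.of (b.coord i) := by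
      have h : (show M →ₗ[Λ] Λ from f)
          = (show M →ₗ[Λ] Λ from ∑ i, star (f (b i)) • SDual.of (b.coord i)) := by
        apply b.ext
        intro j
        have h2 : (∑ i, star (f (b i)) • SDual.of (b.coord i)) (b j) = f (b j) := by
          rw [SDual.sum_apply, Finset.sum_eq_single j]
          · simp
          · intro i _ hij
            simp [hij.symm]
          · simp
        exact h2.symm
      exact h
    conv_rhs => rw [hf, map_sum]
    rw [map_sum, SDual.sum_apply]
    simp

/-- `M ≅ M**` for a f.g. free module. -/
noncomputable def evEquiv : M ≃ₗ[Λ] SDual Λ (SDual Λ M) :=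
  LinearEquiv.ofBijective ev ev_bijective

@[simp] theorem evEquiv_apply (x : M) : evEquiv (Λ := Λ) x = ev x := rfl

theorem apply_evEquiv_symm (Φ : SDual Λ (SDual Λ M)) (f : SDual Λ M) :
    f (evEquiv.symm Φ) = star (Φ f) := by
  have h : ev (Λ := Λ) (evEquiv.symm Φ) = Φ := evEquiv.apply_symm_apply Φ
  conv_rhs => rw [← h]
  simp

theorem sdual_separates {x y : M} (h : ∀ f : SDual Λ M, f x = f y) : x = y := by
  apply ev_bijective (Λ := Λ).1
  ext f
  simp [h f]

end Free

end Duality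

section QGroups

variable {Λ : Type u} [Ring Λ] [StarRing Λ]
variable {M : Type u} [AddCommGroup M] [Module Λ M] {N : Type u} [AddCommGroup N] [Module Λ N]
  {P : Type u} [AddCommGroup P] [Module Λ P]

/-- The `ε`-duality involution `T_ε φ = ε φ*` on `Hom_Λ(M, M*)`. -/
def T (ε : ℤˣ) : (M →ₗ[Λ] SDual Λ M) →+ (M →ₗ[Λ] SDual Λ M) where
  toFun φ := ε • adj φ
  map_zero' := by ext; simp
  map_add' φ ψ := by ext; simp

@[simp] theorem T_apply (ε : ℤˣ) (φ : M →ₗ[Λ] SDual Λ M) (x y : M) :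
    T ε φ x y = ε • star (φ y x) := by
  simp [T]

/-- The image of `1 - T_ε` in `Hom_Λ(M, M*)`. -/
def qRel (Λ : Type u) [Ring Λ] [StarRing Λ] (ε : ℤˣ) (M : Type u) [AddCommGroup M] [Module Λ M] :
    AddSubgroup (M →ₗ[Λ] SDual Λ M) :=
  (AddMonoidHom.id (M →ₗ[Λ] SDual Λ M) - T ε).range

/-- `Q_ε(M) = coker (1 - T_ε)`. -/
abbrev QGrp (Λ : Type u) [Ring Λ] [StarRing Λ] (ε : ℤˣ) (M : Type u) [AddCommGroup M] [Module Λ M] :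
    Type u :=
  (M →ₗ[Λ] SDual Λ M) ⧸ qRel Λ ε M

/-- The class in `Q_ε(M)` of an element of `Hom_Λ(M, M*)`. -/
def QGrp.mk (ε : ℤˣ) : (M →ₗ[Λ] SDual Λ M) →+ QGrp Λ ε M :=
  QuotientAddGroup.mk' (qRel Λ ε M)

theorem QGrp.mk_surjective (ε : ℤˣ) : Function.Surjective (QGrp.mk (Λ := Λ) (M := M) ε) :=
  QuotientAddGroup.mk'_surjective _

/-- The symmetrization `1 + T_ε : Q_ε(M) → Hom_Λ(M, M*)`. -/
def QGrp.sym (ε : ℤˣ) : QGrp Λ ε M →+ (M →ₗ[Λ] SDual Λ M) :=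
  QuotientAddGroup.lift _ (AddMonoidHom.id (M →ₗ[Λ] SDual Λ M) + T ε) (by
    rintro _ ⟨φ, rfl⟩
    ext x y
    rcases Int.units_eq_one_or ε with rfl | rfl <;> simp)

@[simp] theorem QGrp.sym_mk (ε : ℤˣ) (φ : M →ₗ[Λ] SDual Λ M) :
    QGrp.sym ε (QGrp.mk ε φ) = φ + T ε φ := rfl

theorem QGrp.sym_symm (ε : ℤˣ) (ψ : QGrp Λ ε M) (x y : M) :
    star (QGrp.sym ε ψ x y) = ε • QGrp.sym ε ψ y x := by
  obtain ⟨φ, rfl⟩ := QGrp.mk_surjective ε ψ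
  rcases Int.units_eq_one_or ε with rfl | rfl <;> simp [add_comm]

/-- The pull back `φ ↦ f* φ f` of forms along `f : M → N`. -/
def pull (f : M →ₗ[Λ] N) : (N →ₗ[Λ] SDual Λ N) →+ (M →ₗ[Λ] SDual Λ M) where
  toFun φ := dualMap f ∘ₗ φ ∘ₗ f
  map_zero' := by ext; simp
  map_add' φ ψ := by ext; simp

@[simp] theorem pull_apply (f : M →ₗ[Λ] N) (φ : N →ₗ[Λ] SDual Λ N) (x y : M) :
    pull f φ x y = φ (f x) (f y) := rfl

/-- The pull back `ψ ↦ f* ψ f` from `Q_ε(N)` to `Q_ε(M)`. -/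
def QGrp.map {ε : ℤˣ} (f : M →ₗ[Λ] N) : QGrp Λ ε N →+ QGrp Λ ε M :=
  QuotientAddGroup.map _ _ (pull f) (by
    rintro _ ⟨φ, rfl⟩
    refine ⟨pull f φ, ?_⟩
    ext x y
    simp)

@[simp] theorem QGrp.map_mk {ε : ℤˣ} (f : M →ₗ[Λ] N) (φ : N →ₗ[Λ] SDual Λ N) :
    QGrp.map f (QGrp.mk ε φ) = QGrp.mk ε (pull f φ) := rfl

theorem QGrp.map_map {ε : ℤˣ} (f : M →ₗ[Λ] N) (g : N →ₗ[Λ] P) (ψ : QGrp Λ ε P) :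
    QGrp.map f (QGrp.map g ψ) = QGrp.map (g ∘ₗ f) ψ := by
  obtain ⟨φ, rfl⟩ := QGrp.mk_surjective ε ψ
  rfl

theorem QGrp.map_id {ε : ℤˣ} (ψ : QGrp Λ ε M) : QGrp.map LinearMap.id ψ = ψ := by
  obtain ⟨φ, rfl⟩ := QGrp.mk_surjective ε ψ
  rfl

theorem QGrp.sym_map {ε : ℤˣ} (f : M →ₗ[Λ] N) (ψ : QGrp Λ ε N) :
    QGrp.sym ε (QGrp.map f ψ) = pull f (QGrp.sym ε ψ) := by
  obtain ⟨φ, rfl⟩ := QGrp.mk_surjective ε ψ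
  ext x y
  simp

@[simp] theorem QGrp.sym_map_apply {ε : ℤˣ} (f : M →ₗ[Λ] N) (ψ : QGrp Λ ε N) (x y : M) :
    QGrp.sym ε (QGrp.map f ψ) x y = QGrp.sym ε ψ (f x) (f y) := by
  rw [QGrp.sym_map]; rfl

/-- For a f.g. free module `F` and `ν ∈ Q_ε(F*)` the map `(ν + εν*)* : F* → F** = F`. -/
noncomputable def QGrp.toMap [Module.Free Λ M] [Module.Finite Λ M] {ε : ℤˣ}
    (ν : QGrp Λ ε (SDual Λ M)) : SDual Λ M →ₗ[Λ] M :=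
  evEquiv.symm.toLinearMap ∘ₗ adj (QGrp.sym ε ν)

theorem QGrp.apply_toMap [Module.Free Λ M] [Module.Finite Λ M] {ε : ℤˣ}
    (ν : QGrp Λ ε (SDual Λ M)) (f g : SDual Λ M) :
    f (QGrp.toMap ν g) = QGrp.sym ε ν f g := by
  simp [QGrp.toMap, apply_evEquiv_symm]

@[simp] theorem QGrp.toMap_zero [Module.Free Λ M] [Module.Finite Λ M] {ε : ℤˣ} :
    QGrp.toMap (0 : QGrp Λ ε (SDual Λ M)) = 0 := by
  have h : adj (0 : SDual Λ M →ₗ[Λ] SDual Λ (SDual Λ M)) = 0 := by ext; simp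
  simp [QGrp.toMap, h]

/-- The isomorphism `M* ⊕ N* ≅ (M ⊕ N)*`. -/
def dualSum : (SDual Λ M × SDual Λ N) ≃ₗ[Λ] SDual Λ (M × N) where
  toFun p := dualMap (LinearMap.fst Λ M N) p.1 + dualMap (LinearMap.snd Λ M N) p.2
  map_add' p q := by ext x; simp; abel
  map_smul' c p := by ext x; simp
  invFun f := (dualMap (LinearMap.inl Λ M N) f, dualMap (LinearMap.inr Λ M N) f)
  left_inv p := by ext x <;> simp
  right_inv f := by
    ext x
    simp only [SDual.add_apply, dualMap_apply, LinearMap.fst_apply, LinearMap.snd_apply,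
      LinearMap.inl_apply, LinearMap.inr_apply]
    rw [← map_add]
    simp

@[simp] theorem dualSum_apply (p : SDual Λ M × SDual Λ N) (x : M × N) :
    dualSum p x = p.1 x.1 + p.2 x.2 := rfl

/-- The orthogonal sum of two classes of forms. -/
def QGrp.oplus {ε : ℤˣ} (ψ : QGrp Λ ε M) (ψ' : QGrp Λ ε N) : QGrp Λ ε (M × N) :=
  QGrp.map (LinearMap.fst Λ M N) ψ + QGrp.map (LinearMap.snd Λ M N) ψ'

end QGroups

/-- Identification of the elements of a commutative monoid which become equal after addition of
elements of a submonoid. -/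
def stabCon {A : Type v} [AddCommMonoid A] (H : AddSubmonoid A) : AddCon A where
  r a b := ∃ h ∈ H, ∃ h' ∈ H, a + h = b + h'
  iseqv :=
    { refl := fun a => ⟨0, H.zero_mem, 0, H.zero_mem, rfl⟩
      symm := fun ⟨h, hh, h', hh', e⟩ => ⟨h', hh', h, hh, e.symm⟩
      trans := by
        rintro a b c ⟨h, hh, h', hh', e⟩ ⟨k, hk, k', hk', e'⟩
        refine ⟨h + k, H.add_mem hh hk, k' + h', H.add_mem hk' hh', ?_⟩
        rw [← add_assoc, e, add_right_comm, e', add_assoc] }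
  add' := by
    rintro a b c d ⟨h, hh, h', hh', e⟩ ⟨k, hk, k', hk', e'⟩
    refine ⟨h + k, H.add_mem hh hk, h' + k', H.add_mem hh' hk', ?_⟩
    rw [add_add_add_comm, e, e', add_add_add_comm]

/-- A homomorphism which vanishes on `H` induces a homomorphism on the quotient by `stabCon H`. -/
def stabLift {A : Type*} {B : Type*} [AddCommMonoid A] [AddCommMonoid B] (H : AddSubmonoid A)
    (f : A →+ B) (hf : ∀ h ∈ H, f h = 0) : (stabCon H).Quotient →+ B :=
  AddCon.lift (stabCon H) f (by
    rintro a b ⟨h, hh, h', hh', e⟩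
    have e' := congrArg f e
    rw [map_add, map_add, hf h hh, hf h' hh', add_zero, add_zero] at e'
    exact e')

theorem stabMk_eq_zero {A : Type*} [AddCommMonoid A] {H : AddSubmonoid A} {a : A} (h : a ∈ H) :
    (stabCon H).mk' a = 0 :=
  (AddCon.eq _).2 ⟨0, H.zero_mem, a, h, by rw [add_zero, zero_add]⟩

section AsymmetricForms

variable (Λ : Type u) [Ring Λ] [StarRing Λ]

/-- A non-singular asymmetric form `(M, λ : M → M*)` on a f.g. free module. -/
structure AsymForm where
  M : Type u
  [addCommGroup : AddCommGroup M]
  [module : Module Λ M]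
  [free : Module.Free Λ M]
  [finite : Module.Finite Λ M]
  form : M →ₗ[Λ] SDual Λ M
  nonsingular : Function.Bijective form

attribute [instance] AsymForm.addCommGroup AsymForm.module AsymForm.free AsymForm.finite

variable {Λ}

namespace AsymForm

/-- An isomorphism of asymmetric forms. -/
structure Iso (A B : AsymForm Λ) where
  toEquiv : A.M ≃ₗ[Λ] B.M
  form_eq : A.form = dualMap toEquiv.toLinearMap ∘ₗ B.form ∘ₗ toEquiv.toLinearMap

theorem Iso.apply {A B : AsymForm Λ} (f : Iso A B) (x y : A.M) :
    B.form (f.toEquiv x) (f.toEquiv y) = A.form x y := by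
  rw [f.form_eq]; rfl

/-- `L` is a lagrangian: a direct summand with `L = L^⊥`. -/
def IsLagrangian (A : AsymForm Λ) (L : Submodule Λ A.M) : Prop :=
  (∃ K : Submodule Λ A.M, IsCompl L K) ∧ ∀ x : A.M, x ∈ L ↔ ∀ y ∈ L, A.form x y = 0

/-- A form with a lagrangian is metabolic. -/
def IsMetabolic (A : AsymForm Λ) : Prop := ∃ L : Submodule Λ A.M, A.IsLagrangian L

/-- The orthogonal sum. -/
abbrev sum (A B : AsymForm Λ) : AsymForm Λ where
  M := A.M × B.M
  form := dualSum.toLinearMap ∘ₗ A.form.prodMap B.form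
  nonsingular := dualSum.bijective.comp
    ⟨Function.Injective.prodMap A.nonsingular.1 B.nonsingular.1,
      Function.Surjective.prodMap A.nonsingular.2 B.nonsingular.2⟩

@[simp] theorem sum_form (A B : AsymForm Λ) (x y : A.M × B.M) :
    (A.sum B).form x y = A.form x.1 y.1 + B.form x.2 y.2 := rfl

/-- The form on the zero module. -/
abbrev zero : AsymForm Λ where
  M := PUnit.{u + 1}
  form := 0
  nonsingular := ⟨fun _ _ _ => rfl, fun f => ⟨0, by
    ext x
    rw [Subsingleton.elim x 0, map_zero, map_zero]⟩⟩

/-- The form `(M, -λ)`. -/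
abbrev neg (A : AsymForm Λ) : AsymForm Λ where
  M := A.M
  form := -A.form
  nonsingular := by
    have : Function.Bijective (Neg.neg ∘ A.form) :=
      (Equiv.neg (SDual Λ A.M)).bijective.comp A.nonsingular
    exact this

@[simp] theorem neg_form (A : AsymForm Λ) (x y : A.M) : A.neg.form x y = -A.form x y := rfl

/-- The relation of being isomorphic. -/
instance isoSetoid : Setoid (AsymForm Λ) where
  r A B := Nonempty (Iso A B)
  iseqv :=
    { refl := fun A => ⟨⟨LinearEquiv.refl Λ A.M, rfl⟩⟩
      symm := fun {A B} ⟨f⟩ => ⟨⟨f.toEquiv.symm, by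
        ext x y
        simp [f.form_eq]⟩⟩
      trans := fun {A B C} ⟨f⟩ ⟨g⟩ => ⟨⟨f.toEquiv.trans g.toEquiv, by
        ext x y
        simp [f.form_eq, g.form_eq]⟩⟩ }

theorem equiv_of {A B : AsymForm Λ} (e : A.M ≃ₗ[Λ] B.M)
    (h : ∀ x y, A.form x y = B.form (e x) (e y)) : A ≈ B :=
  ⟨⟨e, by ext x y; exact h x y⟩⟩

theorem IsMetabolic.of_equiv {A B : AsymForm Λ} (h : A ≈ B) (hA : A.IsMetabolic) :
    B.IsMetabolic := by
  obtain ⟨f⟩ := h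
  obtain ⟨L, ⟨K, hK⟩, hL⟩ := hA
  refine ⟨L.map f.toEquiv.toLinearMap, ⟨K.map f.toEquiv.toLinearMap, ?_⟩, ?_⟩
  · exact hK.map (Submodule.orderIsoMapComap f.toEquiv)
  · intro x
    obtain ⟨x, rfl⟩ := f.toEquiv.surjective x
    constructor
    · rintro ⟨x', hx', e⟩ _ ⟨y, hy, rfl⟩
      obtain rfl : x' = x := f.toEquiv.injective e
      simpa [f.apply] using (hL x').1 hx' y hy
    · intro h
      refine ⟨x, (hL x).2 fun y hy => ?_, rfl⟩
      simpa [f.apply] using h _ ⟨y, hy, rfl⟩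

theorem IsMetabolic.sum {A B : AsymForm Λ} (hA : A.IsMetabolic) (hB : B.IsMetabolic) :
    (A.sum B).IsMetabolic := by
  obtain ⟨L, ⟨K, hK⟩, hL⟩ := hA
  obtain ⟨L', ⟨K', hK'⟩, hL'⟩ := hB
  refine ⟨L.prod L', ⟨K.prod K', ?_⟩, ?_⟩
  · constructor
    · rw [disjoint_iff, Submodule.prod_inf_prod, hK.inf_eq_bot, hK'.inf_eq_bot, Submodule.prod_bot]
    · rw [codisjoint_iff, Submodule.prod_sup_prod, hK.sup_eq_top, hK'.sup_eq_top,
        Submodule.prod_top]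
  · rintro ⟨x, x'⟩
    constructor
    · rintro ⟨hx, hx'⟩ ⟨y, y'⟩ ⟨hy, hy'⟩
      have h1 := (hL x).1 hx y hy
      have h2 := (hL' x').1 hx' y' hy'
      show A.form x y + B.form x' y' = 0
      rw [h1, h2, add_zero]
    · intro h
      refine ⟨(hL x).2 fun y hy => ?_, (hL' x').2 fun y hy => ?_⟩
      · simpa using h (y, 0) ⟨hy, L'.zero_mem⟩
      · simpa using h (0, y) ⟨L.zero_mem, hy⟩

theorem IsMetabolic.neg {A : AsymForm Λ} (hA : A.IsMetabolic) : A.neg.IsMetabolic := by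
  obtain ⟨L, hK, hL⟩ := hA
  exact ⟨L, hK, fun x => (hL x).trans (by simp)⟩

theorem zero_isMetabolic : (zero : AsymForm Λ).IsMetabolic :=
  ⟨⊤, ⟨⊥, isCompl_top_bot⟩, fun _ => ⟨fun _ _ _ => rfl, fun _ => trivial⟩⟩

/-- The diagonal is a lagrangian of `(M, λ) ⊕ (M, -λ)`. -/
theorem sum_neg_isMetabolic (A : AsymForm Λ) : (A.sum A.neg).IsMetabolic := by
  refine ⟨LinearMap.range ((LinearMap.id (R := Λ) (M := A.M)).prod LinearMap.id),
    ⟨LinearMap.range (LinearMap.inl Λ A.M A.M), ?_⟩, ?_⟩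
  · constructor
    · rw [Submodule.disjoint_def]
      rintro _ ⟨x, rfl⟩ ⟨y, hy⟩
      have h : (0 : A.M) = x := congrArg Prod.snd hy
      subst h
      rfl
    · rw [codisjoint_iff, eq_top_iff]
      rintro ⟨x, y⟩ -
      refine Submodule.mem_sup.2 ⟨(y, y), ⟨y, rfl⟩, (x - y, 0), ⟨x - y, rfl⟩, ?_⟩
      simp
  · rintro ⟨x, x'⟩
    constructor
    · rintro ⟨z, hz⟩ _ ⟨y, rfl⟩
      have h1 : z = x := congrArg Prod.fst hz
      have h2 : z = x' := congrArg Prod.snd hz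
      subst h1 h2
      show A.form z y + -A.form z y = 0
      exact add_neg_cancel _
    · intro h
      have : x = x' := by
        apply A.nonsingular.1
        ext y
        have h1 : A.form x y + -A.form x' y = 0 := h (y, y) ⟨y, rfl⟩
        rwa [← sub_eq_add_neg, sub_eq_zero] at h1
      exact ⟨x, by simp [this]⟩

/-- The commutative monoid of isomorphism classes of non-singular asymmetric forms. -/
def IsoClass (Λ : Type u) [Ring Λ] [StarRing Λ] : Type (u + 1) :=
  Quotient (isoSetoid (Λ := Λ))

/-- The isomorphism class of a form. -/
def toClass (A : AsymForm Λ) : IsoClass Λ := Quotient.mk _ A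

theorem toClass_eq {A B : AsymForm Λ} : A.toClass = B.toClass ↔ A ≈ B := Quotient.eq

instance : Add (IsoClass Λ) :=
  ⟨Quotient.map₂ sum (by
    rintro A A' ⟨f⟩ B B' ⟨g⟩
    exact equiv_of (f.toEquiv.prodCongr g.toEquiv) fun x y => by
      simp [f.apply, g.apply])⟩

instance : Zero (IsoClass Λ) := ⟨zero.toClass⟩

instance : AddCommMonoid (IsoClass Λ) where
  add_assoc := by
    rintro ⟨A⟩ ⟨B⟩ ⟨C⟩
    exact toClass_eq.2 (equiv_of (LinearEquiv.prodAssoc Λ A.M B.M C.M) fun x y => by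
      simp [add_assoc])
  zero_add := by
    rintro ⟨A⟩
    exact toClass_eq.2 (equiv_of (A := zero.sum A)
      (LinearEquiv.uniqueProd (R := Λ) (M := A.M) (M₂ := PUnit.{u + 1})) fun x y => by
        simp [zero])
  add_zero := by
    rintro ⟨A⟩
    exact toClass_eq.2 (equiv_of (A := A.sum zero)
      (LinearEquiv.prodUnique (R := Λ) (M := A.M) (M₂ := PUnit.{u + 1})) fun x y => by
        simp [zero])
  add_comm := by
    rintro ⟨A⟩ ⟨B⟩
    exact toClass_eq.2 (equiv_of (LinearEquiv.prodComm Λ A.M B.M) fun x y => by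
      simp [add_comm])
  nsmul := nsmulRec

theorem toClass_sum (A B : AsymForm Λ) : (A.sum B).toClass = A.toClass + B.toClass := rfl

/-- The submonoid of the classes of metabolic forms. -/
def metabolic (Λ : Type u) [Ring Λ] [StarRing Λ] : AddSubmonoid (IsoClass Λ) where
  carrier := {a | ∃ A : AsymForm Λ, A.IsMetabolic ∧ a = A.toClass}
  zero_mem' := ⟨zero, zero_isMetabolic, rfl⟩
  add_mem' := by
    rintro _ _ ⟨A, hA, rfl⟩ ⟨B, hB, rfl⟩
    exact ⟨A.sum B, hA.sum hB, rfl⟩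

/-- Negation of the form, on isomorphism classes. -/
def negHom (Λ : Type u) [Ring Λ] [StarRing Λ] : IsoClass Λ →+ IsoClass Λ where
  toFun := Quotient.map neg (by
    rintro A B ⟨f⟩
    exact equiv_of f.toEquiv fun x y => by simp [f.apply])
  map_zero' := toClass_eq.2 (equiv_of (LinearEquiv.refl Λ PUnit.{u + 1}) fun x y => by
    simp [zero])
  map_add' := by
    rintro ⟨A⟩ ⟨B⟩
    exact toClass_eq.2 (equiv_of (A := (A.sum B).neg) (B := A.neg.sum B.neg)
      (LinearEquiv.refl Λ (A.M × B.M)) fun x y => by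
        show -(A.form x.1 y.1 + B.form x.2 y.2) = -A.form x.1 y.1 + -B.form x.2 y.2
        exact neg_add _ _)

end AsymForm

/-- The asymmetric Witt group `LAsy⁰(Λ)`: non-singular asymmetric forms, up to isomorphism and
addition of non-singular metabolic forms. -/
def LAsy0 (Λ : Type u) [Ring Λ] [StarRing Λ] : Type (u + 1) :=
  (stabCon (AsymForm.metabolic Λ)).Quotient

instance : AddCommMonoid (LAsy0 Λ) :=
  inferInstanceAs (AddCommMonoid (stabCon (AsymForm.metabolic Λ)).Quotient)

/-- Passage from isomorphism classes to the Witt group. -/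
def LAsy0.proj (Λ : Type u) [Ring Λ] [StarRing Λ] : AsymForm.IsoClass Λ →+ LAsy0 Λ :=
  (stabCon (AsymForm.metabolic Λ)).mk'

/-- The Witt class of a non-singular asymmetric form. -/
def LAsy0.mk (A : AsymForm Λ) : LAsy0 Λ := LAsy0.proj Λ A.toClass

theorem LAsy0.mk_eq_zero {A : AsymForm Λ} (h : A.IsMetabolic) : LAsy0.mk A = 0 :=
  stabMk_eq_zero (H := AsymForm.metabolic Λ) ⟨A, h, rfl⟩

/-- Negation of the form, on Witt classes. -/
def LAsy0.negHom (Λ : Type u) [Ring Λ] [StarRing Λ] : LAsy0 Λ →+ LAsy0 Λ :=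
  stabLift (AsymForm.metabolic Λ) ((LAsy0.proj Λ).comp (AsymForm.negHom Λ)) (by
    rintro _ ⟨A, hA, rfl⟩
    exact LAsy0.mk_eq_zero hA.neg)

theorem LAsy0.exists_rep (a : LAsy0 Λ) : ∃ A : AsymForm Λ, LAsy0.mk A = a := by
  induction a using AddCon.induction_on with
  | H c =>
    obtain ⟨A, rfl⟩ := Quotient.exists_rep c
    exact ⟨A, rfl⟩

instance : AddCommGroup (LAsy0 Λ) where
  neg := LAsy0.negHom Λ
  zsmul := @zsmulRec _ _ _ ⟨LAsy0.negHom Λ⟩ nsmulRec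
  neg_add_cancel a := by
    obtain ⟨A, rfl⟩ := LAsy0.exists_rep a
    have h : LAsy0.mk A + LAsy0.negHom Λ (LAsy0.mk A) = 0 :=
      LAsy0.mk_eq_zero A.sum_neg_isMetabolic
    exact (add_comm _ _).trans h

end AsymmetricForms

section Preformations

variable (Λ : Type u) [Ring Λ] [StarRing Λ] (ε : ℤˣ)

/-- A regular `ε`-quadratic split preformation `(F ←γ- (G, θ) -μ→ F*)`: f.g. free modules `F`, `G`,
maps `γ : G → F` and `μ : G → F*` and `θ ∈ Q_{-ε}(G)` with `γ* μ = θ - εθ*`. -/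
structure SplitPreformation where
  F : Type u
  G : Type u
  [addCommGroupF : AddCommGroup F]
  [moduleF : Module Λ F]
  [freeF : Module.Free Λ F]
  [finiteF : Module.Finite Λ F]
  [addCommGroupG : AddCommGroup G]
  [moduleG : Module Λ G]
  [freeG : Module.Free Λ G]
  [finiteG : Module.Finite Λ G]
  γ : G →ₗ[Λ] F
  μ : G →ₗ[Λ] SDual Λ F
  θ : QGrp Λ (-ε) G
  quadratic : dualMap γ ∘ₗ μ = QGrp.sym (-ε) θ

attribute [instance] SplitPreformation.addCommGroupF SplitPreformation.moduleF
  SplitPreformation.freeF SplitPreformation.finiteF SplitPreformation.addCommGroupG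
  SplitPreformation.moduleG SplitPreformation.freeG SplitPreformation.finiteG

variable {Λ} {ε}

/-- The map `[0 1; 0 0] : L ⊕ L* → (L ⊕ L*)*`, `(x, f) ↦ ((x', f') ↦ f x')`. -/
def hypForm (Λ : Type u) [Ring Λ] [StarRing Λ] (L : Type u) [AddCommGroup L] [Module Λ L] :
    (L × SDual Λ L) →ₗ[Λ] SDual Λ (L × SDual Λ L) :=
  dualMap (LinearMap.fst Λ L (SDual Λ L)) ∘ₗ LinearMap.snd Λ L (SDual Λ L)

@[simp] theorem hypForm_apply (L : Type u) [AddCommGroup L] [Module Λ L] (x y : L × SDual Λ L) :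
    hypForm Λ L x y = x.2 y.1 := rfl

/-- The hyperbolic `ε`-quadratic form `H_ε(L)` on `L ⊕ L*`. -/
def hyp (Λ : Type u) [Ring Λ] [StarRing Λ] (ε : ℤˣ) (L : Type u) [AddCommGroup L] [Module Λ L] :
    QGrp Λ ε (L × SDual Λ L) :=
  QGrp.mk ε (hypForm Λ L)

/-- `L` is a lagrangian of the `ε`-quadratic form `(M, ψ)`: a direct summand, on which `ψ`
vanishes, and which equals its annihilator under the symmetrization of `ψ`. -/
def IsQuadraticLagrangian {M : Type u} [AddCommGroup M] [Module Λ M] (ψ : QGrp Λ ε M)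
    (L : Submodule Λ M) : Prop :=
  (∃ K : Submodule Λ M, IsCompl L K) ∧ QGrp.map L.subtype ψ = 0 ∧
    LinearMap.ker (dualMap L.subtype ∘ₗ QGrp.sym ε ψ) = L

namespace SplitPreformation

/-- `z` is a non-singular split formation: `(γ, μ) : G → F ⊕ F*` is the inclusion of a lagrangian
of the hyperbolic form `H_ε(F)`. -/
def IsNonsingularFormation (z : SplitPreformation Λ ε) : Prop :=
  Function.Injective (z.γ.prod z.μ) ∧
    IsQuadraticLagrangian (hyp Λ ε z.F) (LinearMap.range (z.γ.prod z.μ))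

theorem quadratic_apply (z : SplitPreformation Λ ε) (x y : z.G) :
    QGrp.sym (-ε) z.θ x y = z.μ x (z.γ y) := by
  rw [← z.quadratic]; rfl

/-- The sum of preformations. -/
abbrev sum (z w : SplitPreformation Λ ε) : SplitPreformation Λ ε where
  F := z.F × w.F
  G := z.G × w.G
  γ := z.γ.prodMap w.γ
  μ := dualSum.toLinearMap ∘ₗ z.μ.prodMap w.μ
  θ := QGrp.oplus z.θ w.θ
  quadratic := by
    ext x y <;> simp [QGrp.oplus, quadratic_apply]

/-- The zero preformation. -/
abbrev zero : SplitPreformation Λ ε where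
  F := PUnit.{u + 1}
  G := PUnit.{u + 1}
  γ := 0
  μ := 0
  θ := 0
  quadratic := by simp

/-- The flip `(F* ←εμ- (G, -θ) -γ→ F = F**)`. -/
abbrev flip (z : SplitPreformation Λ ε) : SplitPreformation Λ ε where
  F := SDual Λ z.F
  G := z.G
  γ := ε • z.μ
  μ := ev ∘ₗ z.γ
  θ := -z.θ
  quadratic := by
    ext x y
    have h := QGrp.sym_symm (-ε) z.θ y x
    rw [quadratic_apply, quadratic_apply] at h
    rcases Int.units_eq_one_or ε with rfl | rfl <;>
      simp [quadratic_apply, h]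

/-- The boundary `(K ←1- (K, θ) -(θ-εθ*)→ K*)` of a `(-ε)`-quadratic form `(K, θ)`. -/
abbrev boundary (K : Type u) [AddCommGroup K] [Module Λ K] [Module.Free Λ K] [Module.Finite Λ K]
    (θ : QGrp Λ (-ε) K) : SplitPreformation Λ ε where
  F := K
  G := K
  γ := LinearMap.id
  μ := QGrp.sym (-ε) θ
  θ := θ
  quadratic := rfl

/-- The boundary of the hyperbolic form `H_{-ε}(L)`. -/
abbrev hypBoundary (Λ : Type u) [Ring Λ] [StarRing Λ] (ε : ℤˣ) (L : Type u) [AddCommGroup L]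
    [Module Λ L] [Module.Free Λ L] [Module.Finite Λ L] : SplitPreformation Λ ε :=
  boundary (L × SDual Λ L) (hyp Λ (-ε) L)

/-- A strong isomorphism of split preformations. -/
structure StrongIso (z z' : SplitPreformation Λ ε) where
  α : z.F ≃ₗ[Λ] z'.F
  β : z.G ≃ₗ[Λ] z'.G
  comm_γ : α.toLinearMap ∘ₗ z.γ = z'.γ ∘ₗ β.toLinearMap
  comm_μ : dualMap α.symm.toLinearMap ∘ₗ z.μ = z'.μ ∘ₗ β.toLinearMap
  comm_θ : z.θ = QGrp.map β.toLinearMap z'.θ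

/-- A (weak) isomorphism of split preformations. -/
structure WeakIso (z z' : SplitPreformation Λ ε) where
  α : z.F ≃ₗ[Λ] z'.F
  β : z.G ≃ₗ[Λ] z'.G
  ν : QGrp Λ (-ε) (SDual Λ z.F)
  comm_γ : α.toLinearMap ∘ₗ z.γ + α.toLinearMap ∘ₗ QGrp.toMap ν ∘ₗ z.μ = z'.γ ∘ₗ β.toLinearMap
  comm_μ : dualMap α.symm.toLinearMap ∘ₗ z.μ = z'.μ ∘ₗ β.toLinearMap
  comm_θ : z.θ + QGrp.map z.μ ν = QGrp.map β.toLinearMap z'.θ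

/-- A flip-isomorphism of `z`: a weak isomorphism of `z` with its flip. -/
abbrev FlipIso (z : SplitPreformation Λ ε) : Type u := WeakIso z z.flip

end SplitPreformation
end Preformations

section FlipPairs

variable {Λ : Type u} [Ring Λ] [StarRing Λ] {ε : ℤˣ}

namespace SplitPreformation

theorem StrongIso.apply_γ {z w : SplitPreformation Λ ε} (f : StrongIso z w) (x : z.G) :
    w.γ (f.β x) = f.α (z.γ x) :=
  (LinearMap.congr_fun f.comm_γ x).symm

theorem StrongIso.apply_μ {z w : SplitPreformation Λ ε} (f : StrongIso z w) (x : z.G) (y : z.F) :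
    w.μ (f.β x) (f.α y) = z.μ x y := by
  have h := congrArg (fun g : SDual Λ w.F => g (f.α y)) (LinearMap.congr_fun f.comm_μ x)
  simpa using h.symm

/-- A strong isomorphism from pointwise identities. -/
def StrongIso.of {z w : SplitPreformation Λ ε} (α : z.F ≃ₗ[Λ] w.F) (β : z.G ≃ₗ[Λ] w.G)
    (hγ : ∀ x, w.γ (β x) = α (z.γ x)) (hμ : ∀ x y, w.μ (β x) (α y) = z.μ x y)
    (hθ : z.θ = QGrp.map β.toLinearMap w.θ) : StrongIso z w where
  α := α
  β := β
  comm_γ := by ext x; exact (hγ x).symm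
  comm_μ := by
    ext x y
    have h := hμ x (α.symm y)
    rw [α.apply_symm_apply] at h
    exact h.symm
  comm_θ := hθ

/-- The identity. -/
def StrongIso.refl (z : SplitPreformation Λ ε) : StrongIso z z :=
  .of (LinearEquiv.refl Λ z.F) (LinearEquiv.refl Λ z.G) (fun _ => rfl) (fun _ _ => rfl)
    (QGrp.map_id _).symm

/-- The inverse. -/
def StrongIso.symm {z w : SplitPreformation Λ ε} (f : StrongIso z w) : StrongIso w z :=
  .of f.α.symm f.β.symm
    (fun x => by
      obtain ⟨x, rfl⟩ := f.β.surjective x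
      simp [f.apply_γ])
    (fun x y => by
      obtain ⟨x, rfl⟩ := f.β.surjective x
      obtain ⟨y, rfl⟩ := f.α.surjective y
      simp [f.apply_μ])
    (by
      rw [f.comm_θ, QGrp.map_map]
      have h : f.β.toLinearMap ∘ₗ f.β.symm.toLinearMap = LinearMap.id := by ext x; simp
      rw [h, QGrp.map_id])

/-- The composition. -/
def StrongIso.trans {z w v : SplitPreformation Λ ε} (f : StrongIso z w) (g : StrongIso w v) :
    StrongIso z v :=
  .of (f.α.trans g.α) (f.β.trans g.β)
    (fun x => by simp [f.apply_γ, g.apply_γ])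
    (fun x y => by simp [f.apply_μ, g.apply_μ])
    (by rw [f.comm_θ, g.comm_θ, QGrp.map_map]; rfl)

/-- The sum of strong isomorphisms. -/
def StrongIso.sum {z z' w w' : SplitPreformation Λ ε} (f : StrongIso z z') (g : StrongIso w w') :
    StrongIso (z.sum w) (z'.sum w') :=
  .of (f.α.prodCongr g.α) (f.β.prodCongr g.β)
    (fun x => by simp [f.apply_γ, g.apply_γ])
    (fun x y => by simp [f.apply_μ, g.apply_μ])
    (by
      simp only [QGrp.oplus, map_add, QGrp.map_map, f.comm_θ, g.comm_θ]
      rfl)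

/-- Associativity of the sum. -/
def assocIso (z w v : SplitPreformation Λ ε) :
    StrongIso ((z.sum w).sum v) (z.sum (w.sum v)) :=
  .of (LinearEquiv.prodAssoc Λ z.F w.F v.F) (LinearEquiv.prodAssoc Λ z.G w.G v.G)
    (fun _ => rfl) (fun x y => by simp [add_assoc])
    (by
      simp only [QGrp.oplus, map_add, QGrp.map_map, add_assoc]
      rfl)

/-- Commutativity of the sum. -/
def commIso (z w : SplitPreformation Λ ε) : StrongIso (z.sum w) (w.sum z) :=
  .of (LinearEquiv.prodComm Λ z.F w.F) (LinearEquiv.prodComm Λ z.G w.G)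
    (fun _ => rfl) (fun x y => by simp [add_comm])
    (by
      simp only [QGrp.oplus, map_add, QGrp.map_map]
      rw [add_comm]
      rfl)

/-- The zero preformation is neutral. -/
def sumZeroIso (z : SplitPreformation Λ ε) : StrongIso (z.sum zero) z :=
  .of (w := z) (LinearEquiv.prodUnique (R := Λ) (M := z.F) (M₂ := PUnit.{u + 1}))
    (LinearEquiv.prodUnique (R := Λ) (M := z.G) (M₂ := PUnit.{u + 1}))
    (fun _ => rfl) (fun x y => by simp)
    (by
      simp only [QGrp.oplus, map_zero, add_zero]
      rfl)

/-- The relation of being strongly isomorphic. -/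
instance isoSetoid : Setoid (SplitPreformation Λ ε) where
  r z w := Nonempty (StrongIso z w)
  iseqv :=
    { refl := fun z => ⟨.refl z⟩
      symm := fun ⟨f⟩ => ⟨f.symm⟩
      trans := fun ⟨f⟩ ⟨g⟩ => ⟨f.trans g⟩ }

/-- The commutative monoid of strong isomorphism classes of regular split preformations. -/
def IsoClass (Λ : Type u) [Ring Λ] [StarRing Λ] (ε : ℤˣ) : Type (u + 1) :=
  Quotient (isoSetoid (Λ := Λ) (ε := ε))

/-- The strong isomorphism class. -/
def toClass (z : SplitPreformation Λ ε) : IsoClass Λ ε := Quotient.mk _ z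

theorem toClass_eq {z w : SplitPreformation Λ ε} :
    z.toClass = w.toClass ↔ Nonempty (StrongIso z w) := Quotient.eq

instance : Add (IsoClass Λ ε) :=
  ⟨Quotient.map₂ sum (by
    rintro z z' ⟨f⟩ w w' ⟨g⟩
    exact ⟨f.sum g⟩)⟩

instance : Zero (IsoClass Λ ε) := ⟨zero.toClass⟩

theorem toClass_sum (z w : SplitPreformation Λ ε) :
    (z.sum w).toClass = z.toClass + w.toClass := rfl

instance : AddCommMonoid (IsoClass Λ ε) where
  add_assoc := by
    rintro ⟨z⟩ ⟨w⟩ ⟨v⟩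
    exact toClass_eq.2 ⟨assocIso z w v⟩
  zero_add := by
    rintro ⟨z⟩
    exact toClass_eq.2 ⟨(commIso zero z).trans (sumZeroIso z)⟩
  add_zero := by
    rintro ⟨z⟩
    exact toClass_eq.2 ⟨sumZeroIso z⟩
  add_comm := by
    rintro ⟨z⟩ ⟨w⟩
    exact toClass_eq.2 ⟨commIso z w⟩
  nsmul := nsmulRec

theorem FlipIso.apply_γ {z : SplitPreformation Λ ε} (t : FlipIso z) (x : z.G) :
    t.α (z.γ x) + t.α (QGrp.toMap t.ν (z.μ x)) = ε • z.μ (t.β x) :=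
  LinearMap.congr_fun t.comm_γ x

theorem FlipIso.apply_μ {z : SplitPreformation Λ ε} (t : FlipIso z) (x : z.G) (y : z.F) :
    star (t.α y (z.γ (t.β x))) = z.μ x y := by
  have h := congrArg (fun g : SDual Λ (SDual Λ z.F) => g (t.α y)) (LinearMap.congr_fun t.comm_μ x)
  simpa using h.symm

/-- A flip-isomorphism from pointwise identities. -/
def FlipIso.of {z : SplitPreformation Λ ε} (α : z.F ≃ₗ[Λ] SDual Λ z.F) (β : z.G ≃ₗ[Λ] z.G)
    (ν : QGrp Λ (-ε) (SDual Λ z.F))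
    (hγ : ∀ x y, α (z.γ x) y + α (QGrp.toMap ν (z.μ x)) y = ε • z.μ (β x) y)
    (hμ : ∀ x y, star (α y (z.γ (β x))) = z.μ x y)
    (hθ : z.θ + QGrp.map z.μ ν = QGrp.map β.toLinearMap (-z.θ)) : FlipIso z where
  α := α
  β := β
  ν := ν
  comm_γ := by
    ext x y
    have h := hγ x y
    rw [← SDual.units_smul_apply] at h
    exact h
  comm_μ := by
    ext x y
    have h := hμ x (α.symm y)
    rw [α.apply_symm_apply] at h
    exact h.symm
  comm_θ := hθ

theorem toMap_oplus {M N : Type u} [AddCommGroup M] [Module Λ M] [Module.Free Λ M]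
    [Module.Finite Λ M] [AddCommGroup N] [Module Λ N] [Module.Free Λ N] [Module.Finite Λ N]
    {δ : ℤˣ} (ν : QGrp Λ δ (SDual Λ M)) (ν' : QGrp Λ δ (SDual Λ N)) (g : SDual Λ (M × N)) :
    QGrp.toMap (QGrp.map (dualMap (LinearMap.inl Λ M N)) ν
      + QGrp.map (dualMap (LinearMap.inr Λ M N)) ν') g
      = (QGrp.toMap ν (dualMap (LinearMap.inl Λ M N) g),
        QGrp.toMap ν' (dualMap (LinearMap.inr Λ M N) g)) := by
  apply sdual_separates (Λ := Λ)
  intro f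
  have h : ∀ p : M × N, f p = dualMap (LinearMap.inl Λ M N) f p.1
      + dualMap (LinearMap.inr Λ M N) f p.2 := fun p => by
    rw [dualMap_apply, dualMap_apply, ← map_add]
    simp
  rw [QGrp.apply_toMap, h (QGrp.toMap ν _, QGrp.toMap ν' _), QGrp.apply_toMap,
    QGrp.apply_toMap]
  simp

/-- The sum of flip-isomorphisms. -/
def FlipIso.sum {z w : SplitPreformation Λ ε} (t : FlipIso z) (s : FlipIso w) :
    FlipIso (z.sum w) :=
  FlipIso.of (z := z.sum w) ((t.α.prodCongr s.α).trans dualSum) (t.β.prodCongr s.β)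
    (QGrp.map (dualMap (LinearMap.inl Λ z.F w.F)) t.ν
      + QGrp.map (dualMap (LinearMap.inr Λ z.F w.F)) s.ν)
    (fun x y => by
      have h1 := congrArg (fun g : SDual Λ z.F => g y.1) (FlipIso.apply_γ t x.1)
      have h2 := congrArg (fun g : SDual Λ w.F => g y.2) (FlipIso.apply_γ s x.2)
      have e1 : dualMap (LinearMap.inl Λ z.F w.F) ((z.sum w).μ x) = z.μ x.1 := by
        ext a; simp
      have e2 : dualMap (LinearMap.inr Λ z.F w.F) ((z.sum w).μ x) = w.μ x.2 := by
        ext a; simp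
      rw [toMap_oplus, e1, e2]
      simp only [SDual.add_apply, SDual.units_smul_apply] at h1 h2
      show (t.α (z.γ x.1) y.1 + s.α (w.γ x.2) y.2) +
        (t.α (QGrp.toMap t.ν (z.μ x.1)) y.1 + s.α (QGrp.toMap s.ν (w.μ x.2)) y.2)
        = ε • (z.μ (t.β x.1) y.1 + w.μ (s.β x.2) y.2)
      rw [add_add_add_comm, h1, h2, smul_add])
    (fun x y => by
      show star (t.α y.1 (z.γ (t.β x.1)) + s.α y.2 (w.γ (s.β x.2))) = z.μ x.1 y.1 + w.μ x.2 y.2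
      rw [star_add, FlipIso.apply_μ, FlipIso.apply_μ])
    (by
      have h1 := congrArg (QGrp.map (LinearMap.fst Λ z.G w.G)) t.comm_θ
      have h2 := congrArg (QGrp.map (LinearMap.snd Λ z.G w.G)) s.comm_θ
      have h3 := congrArg₂ (· + ·) h1 h2
      simp only [QGrp.oplus, map_add, map_neg, QGrp.map_map, neg_add] at h3 ⊢
      rw [add_add_add_comm] at h3
      convert h3 using 4
      · congr 1
        ext x y <;> simp
      · congr 1
        ext x y <;> simp
      · rfl
      · rfl)

end SplitPreformation

open SplitPreformation

/-- A regular split preformation together with a flip-isomorphism. -/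
structure FlipPair (Λ : Type u) [Ring Λ] [StarRing Λ] (ε : ℤˣ) where
  z : SplitPreformation Λ ε
  t : FlipIso z

namespace FlipPair

/-- An isomorphism of the tuples `(z, t)` and `(z', t')`: a strong isomorphism `(η, ζ)` such that
`α' = η^{-*} α η⁻¹`, `β' = ζ β ζ⁻¹` and `ν' = η ν η*`. -/
structure Iso (a b : FlipPair Λ ε) where
  toStrong : StrongIso a.z b.z
  comm_α : b.t.α.toLinearMap
    = dualMap toStrong.α.symm.toLinearMap ∘ₗ a.t.α.toLinearMap ∘ₗ toStrong.α.symm.toLinearMap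
  comm_β : b.t.β.toLinearMap
    = toStrong.β.toLinearMap ∘ₗ a.t.β.toLinearMap ∘ₗ toStrong.β.symm.toLinearMap
  comm_ν : b.t.ν = QGrp.map (dualMap toStrong.α.toLinearMap) a.t.ν

theorem Iso.apply_α {a b : FlipPair Λ ε} (f : Iso a b) (x y : a.z.F) :
    b.t.α (f.toStrong.α x) (f.toStrong.α y) = a.t.α x y := by
  have h := LinearMap.congr_fun f.comm_α (f.toStrong.α x)
  have h' := congrArg (fun g : SDual Λ b.z.F => g (f.toStrong.α y)) h
  simpa using h'

theorem Iso.apply_β {a b : FlipPair Λ ε} (f : Iso a b) (x : a.z.G) :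
    b.t.β (f.toStrong.β x) = f.toStrong.β (a.t.β x) := by
  have h := LinearMap.congr_fun f.comm_β (f.toStrong.β x)
  simpa using h

/-- An isomorphism of tuples from pointwise identities. -/
def Iso.of {a b : FlipPair Λ ε} (f : StrongIso a.z b.z)
    (hα : ∀ x y, b.t.α (f.α x) (f.α y) = a.t.α x y)
    (hβ : ∀ x, b.t.β (f.β x) = f.β (a.t.β x))
    (hν : b.t.ν = QGrp.map (dualMap f.α.toLinearMap) a.t.ν) : Iso a b where
  toStrong := f
  comm_α := by
    ext x y
    obtain ⟨x, rfl⟩ := f.α.surjective x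
    obtain ⟨y, rfl⟩ := f.α.surjective y
    have h := hα x y
    have e1 : f.α.symm (f.α x) = x := f.α.symm_apply_apply x
    have e2 : f.α.symm (f.α y) = y := f.α.symm_apply_apply y
    show b.t.α (f.α x) (f.α y) = a.t.α (f.α.symm (f.α x)) (f.α.symm (f.α y))
    rw [h, e1, e2]
  comm_β := by
    ext x
    obtain ⟨x, rfl⟩ := f.β.surjective x
    have e1 : f.β.symm (f.β x) = x := f.β.symm_apply_apply x
    show b.t.β (f.β x) = f.β (a.t.β (f.β.symm (f.β x)))
    rw [hβ, e1]
  comm_ν := hν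

/-- The sum of tuples. -/
abbrev sum (a b : FlipPair Λ ε) : FlipPair Λ ε := ⟨a.z.sum b.z, FlipIso.sum a.t b.t⟩

theorem sum_α (a b : FlipPair Λ ε) (x y : a.z.F × b.z.F) :
    (FlipIso.sum a.t b.t).α x y = a.t.α x.1 y.1 + b.t.α x.2 y.2 := rfl

theorem sum_β (a b : FlipPair Λ ε) (x : a.z.G × b.z.G) :
    (FlipIso.sum a.t b.t).β x = (a.t.β x.1, b.t.β x.2) := rfl

theorem sum_ν {z w : SplitPreformation Λ ε} (t : FlipIso z) (s : FlipIso w) :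
    (FlipIso.sum t s).ν = QGrp.map (dualMap (LinearMap.inl Λ z.F w.F)) t.ν
      + QGrp.map (dualMap (LinearMap.inr Λ z.F w.F)) s.ν := rfl

/-- The zero preformation with its flip-isomorphism. -/
abbrev zero : FlipPair Λ ε where
  z := SplitPreformation.zero
  t := FlipIso.of (z := SplitPreformation.zero)
    ⟨0, 0, fun _ => rfl, fun f => SDual.ext fun x => by
      rw [Subsingleton.elim x 0, map_zero, map_zero]⟩ (LinearEquiv.refl Λ PUnit.{u + 1}) 0
    (fun x y => by simp) (fun x y => by simp) (by simp)

/-- The relation of being isomorphic. -/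
instance isoSetoid : Setoid (FlipPair Λ ε) where
  r a b := Nonempty (Iso a b)
  iseqv :=
    { refl := fun a => ⟨.of (.refl a.z) (fun _ _ => rfl) (fun _ => rfl) (QGrp.map_id _).symm⟩
      symm := fun {a b} ⟨f⟩ => ⟨.of f.toStrong.symm
        (fun x y => by
          obtain ⟨x, rfl⟩ := f.toStrong.α.surjective x
          obtain ⟨y, rfl⟩ := f.toStrong.α.surjective y
          rw [f.apply_α]
          exact congrArg₂ (fun p q => a.t.α p q) (f.toStrong.α.symm_apply_apply x)
            (f.toStrong.α.symm_apply_apply y))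
        (fun x => by
          obtain ⟨x, rfl⟩ := f.toStrong.β.surjective x
          rw [f.apply_β]
          exact (congrArg a.t.β (f.toStrong.β.symm_apply_apply x)).trans
            (f.toStrong.β.symm_apply_apply _).symm)
        (by
          rw [f.comm_ν, QGrp.map_map]
          have h : dualMap f.toStrong.α.toLinearMap ∘ₗ dualMap f.toStrong.symm.α.toLinearMap
              = LinearMap.id := by
            ext g x
            exact congrArg g (f.toStrong.α.symm_apply_apply x)
          rw [h, QGrp.map_id])⟩
      trans := fun {a b c} ⟨f⟩ ⟨g⟩ => ⟨.of (f.toStrong.trans g.toStrong)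
        (fun x y => (g.apply_α _ _).trans (f.apply_α _ _))
        (fun x => (g.apply_β _).trans (congrArg g.toStrong.β (f.apply_β _)))
        (by
          rw [g.comm_ν, f.comm_ν, QGrp.map_map]
          rfl)⟩ }

/-- The commutative monoid of isomorphism classes of tuples `(z, t)`. -/
def IsoClass (Λ : Type u) [Ring Λ] [StarRing Λ] (ε : ℤˣ) : Type (u + 1) :=
  Quotient (isoSetoid (Λ := Λ) (ε := ε))

/-- The isomorphism class of a tuple. -/
def toClass (a : FlipPair Λ ε) : IsoClass Λ ε := Quotient.mk _ a

theorem toClass_eq {a b : FlipPair Λ ε} : a.toClass = b.toClass ↔ Nonempty (Iso a b) :=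
  Quotient.eq

/-- The sum of isomorphisms of tuples. -/
def Iso.sum {a a' b b' : FlipPair Λ ε} (f : Iso a a') (g : Iso b b') :
    Iso (a.sum b) (a'.sum b') :=
  .of (f.toStrong.sum g.toStrong)
    (fun x y => congrArg₂ (· + ·) (f.apply_α _ _) (g.apply_α _ _))
    (fun x => Prod.ext (f.apply_β _) (g.apply_β _))
    (by
      simp only [sum_ν, map_add, QGrp.map_map, f.comm_ν, g.comm_ν]
      congr 2
      · congr 1
        ext h x
        exact congrArg h (Prod.ext rfl (map_zero g.toStrong.α).symm)
      · congr 1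
        ext h x
        exact congrArg h (Prod.ext (map_zero f.toStrong.α).symm rfl))

instance : Add (IsoClass Λ ε) :=
  ⟨Quotient.map₂ sum (by
    rintro a a' ⟨f⟩ b b' ⟨g⟩
    exact ⟨f.sum g⟩)⟩

instance : Zero (IsoClass Λ ε) := ⟨zero.toClass⟩

theorem toClass_sum (a b : FlipPair Λ ε) : (a.sum b).toClass = a.toClass + b.toClass := rfl

theorem add_comm_class (a b : IsoClass Λ ε) : a + b = b + a := by
  obtain ⟨a, rfl⟩ := Quotient.exists_rep a
  obtain ⟨b, rfl⟩ := Quotient.exists_rep b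
  exact toClass_eq.2 ⟨.of (commIso a.z b.z) (fun x y => add_comm _ _) (fun _ => rfl) (by
    simp only [sum_ν, map_add, QGrp.map_map]
    rw [add_comm]
    rfl)⟩

theorem add_zero_class (a : IsoClass Λ ε) : a + 0 = a := by
  obtain ⟨a, rfl⟩ := Quotient.exists_rep a
  refine toClass_eq.2 ⟨.of (a := a.sum zero) (sumZeroIso a.z) (fun x y => ?_) (fun _ => rfl) ?_⟩
  · exact (add_zero (a.t.α x.1 y.1)).symm
  · rw [sum_ν a.t zero.t, map_add, QGrp.map_map]
    have h : (zero (Λ := Λ) (ε := ε)).t.ν = 0 := rfl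
    rw [h, map_zero, map_zero, add_zero]
    exact (QGrp.map_id _).symm

instance : AddCommMonoid (IsoClass Λ ε) where
  add_assoc := by
    rintro ⟨a⟩ ⟨b⟩ ⟨c⟩
    exact toClass_eq.2 ⟨.of (assocIso a.z b.z c.z) (fun x y => (add_assoc _ _ _).symm)
      (fun _ => rfl) (by
        rw [sum_ν a.t (FlipIso.sum b.t c.t), sum_ν b.t c.t, sum_ν (FlipIso.sum a.t b.t) c.t,
          sum_ν a.t b.t]
        simp only [map_add, QGrp.map_map, add_assoc]
        rfl)⟩
  zero_add a := (add_comm_class _ _).trans (add_zero_class a)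
  add_zero := add_zero_class
  add_comm := add_comm_class
  nsmul := nsmulRec

end FlipPair
end FlipPairs

section Monoids

variable {Λ : Type u} [Ring Λ] [StarRing Λ] {ε : ℤˣ}

open SplitPreformation

/-- Multiplication by a sign. -/
def signEquiv (Λ : Type u) [Ring Λ] (δ : ℤˣ) (M : Type u) [AddCommGroup M] [Module Λ M] :
    M ≃ₗ[Λ] M where
  toFun x := δ • x
  map_add' := smul_add δ
  map_smul' c x := by rcases Int.units_eq_one_or δ with rfl | rfl <;> simp
  invFun x := δ • x
  left_inv x := by rcases Int.units_eq_one_or δ with rfl | rfl <;> simp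
  right_inv x := by rcases Int.units_eq_one_or δ with rfl | rfl <;> simp

@[simp] theorem signEquiv_apply (δ : ℤˣ) (M : Type u) [AddCommGroup M] [Module Λ M] (x : M) :
    signEquiv Λ δ M x = δ • x := rfl

section Hyperbolic

variable (Λ ε) (L : Type u) [AddCommGroup L] [Module Λ L] [Module.Free Λ L] [Module.Finite Λ L]

/-- The isomorphism `[0 -ε; -1 0] : L ⊕ L* → (L ⊕ L*)* = L* ⊕ L`. -/
noncomputable def hypFlipα : (L × SDual Λ L) ≃ₗ[Λ] SDual Λ (L × SDual Λ L) :=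
  (LinearEquiv.prodComm Λ L (SDual Λ L)).trans
    (((signEquiv Λ (-ε) (SDual Λ L)).prodCongr
      ((evEquiv (Λ := Λ) (M := L)).trans (LinearEquiv.neg Λ))).trans dualSum)

theorem hypFlipα_apply (x y : L × SDual Λ L) :
    hypFlipα Λ ε L x y = (-ε) • x.2 y.1 - star (y.2 x.1) := by
  simp [hypFlipα, sub_eq_add_neg]

/-- The isomorphism `[1 0; 0 -1]` of `L ⊕ L*`. -/
def hypFlipβ : (L × SDual Λ L) ≃ₗ[Λ] (L × SDual Λ L) :=
  (LinearEquiv.refl Λ L).prodCongr (LinearEquiv.neg Λ)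

theorem hypFlipβ_apply (x : L × SDual Λ L) : hypFlipβ Λ L x = (x.1, -x.2) := rfl

theorem hypBoundary_μ (x y : L × SDual Λ L) :
    (hypBoundary Λ ε L).μ x y = x.2 y.1 - ε • star (y.2 x.1) := by
  show QGrp.sym (-ε) (QGrp.mk (-ε) (hypForm Λ L)) x y = _
  rw [QGrp.sym_mk]
  simp [sub_eq_add_neg]

theorem hyp_neg : QGrp.map (hypFlipβ Λ L).toLinearMap (-hyp Λ (-ε) L) = hyp Λ (-ε) L := by
  rw [hyp, ← map_neg, QGrp.map_mk]
  congr 1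
  ext x y <;> simp [hypFlipβ]

/-- The boundary of `H_{-ε}(L)` together with the strong flip-isomorphism
`([0 -ε; -1 0], [1 0; 0 -1], 0)`. -/
noncomputable abbrev hypPair : FlipPair Λ ε where
  z := hypBoundary Λ ε L
  t := FlipIso.of (z := hypBoundary Λ ε L) (hypFlipα Λ ε L) (hypFlipβ Λ L) 0
    (fun x y => by
      rw [QGrp.toMap_zero, LinearMap.zero_apply, map_zero, SDual.zero_apply, add_zero, hypBoundary_μ]
      show hypFlipα Λ ε L x y = _
      rw [hypFlipα_apply, hypFlipβ_apply]
      rcases Int.units_eq_one_or ε with rfl | rfl <;> simp <;> abel)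
    (fun x y => by
      rw [hypBoundary_μ]
      show star (hypFlipα Λ ε L y (hypFlipβ Λ L x)) = _
      rw [hypFlipα_apply, hypFlipβ_apply]
      rcases Int.units_eq_one_or ε with rfl | rfl <;> simp <;> abel)
    (by
      rw [map_zero, add_zero]
      exact (hyp_neg Λ ε L).symm)

variable {Λ ε L}
variable {L' : Type u} [AddCommGroup L'] [Module Λ L'] [Module.Free Λ L'] [Module.Finite Λ L']
  {L'' : Type u} [AddCommGroup L''] [Module Λ L''] [Module.Free Λ L''] [Module.Finite Λ L'']

/-- The isomorphism `(L ⊕ L*) ⊕ (L' ⊕ L'*) ≅ L'' ⊕ L''*` for `L ⊕ L' ≅ L''`. -/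
def hypSumEquiv (e : (L × L') ≃ₗ[Λ] L'') :
    ((L × SDual Λ L) × (L' × SDual Λ L')) ≃ₗ[Λ] (L'' × SDual Λ L'') where
  toFun p := (e (p.1.1, p.2.1), dualMap e.symm.toLinearMap (dualSum (p.1.2, p.2.2)))
  map_add' p q := by
    ext1
    · show e (p.1.1 + q.1.1, p.2.1 + q.2.1) = e (p.1.1, p.2.1) + e (q.1.1, q.2.1)
      rw [← map_add]; rfl
    · show dualMap e.symm.toLinearMap (dualSum (p.1.2 + q.1.2, p.2.2 + q.2.2)) =
        dualMap e.symm.toLinearMap (dualSum (p.1.2, p.2.2))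
          + dualMap e.symm.toLinearMap (dualSum (q.1.2, q.2.2))
      rw [← map_add, ← map_add]; rfl
  map_smul' c p := by
    ext1
    · exact map_smul e c (p.1.1, p.2.1)
    · show dualMap e.symm.toLinearMap (dualSum (c • (p.1.2, p.2.2))) = _
      rw [map_smul, map_smul]; rfl
  invFun w := (((e.symm w.1).1, (dualSum.symm (dualMap e.toLinearMap w.2)).1),
    ((e.symm w.1).2, (dualSum.symm (dualMap e.toLinearMap w.2)).2))
  left_inv p := by
    have h : dualMap e.toLinearMap (dualMap e.symm.toLinearMap (dualSum (p.1.2, p.2.2)))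
        = dualSum (p.1.2, p.2.2) := by
      ext x; simp
    simp only [h, LinearEquiv.symm_apply_apply]
  right_inv w := by
    ext1
    · simp
    · ext x
      simp

theorem hypSumEquiv_snd_fst (e : (L × L') ≃ₗ[Λ] L'')
    (x y : (L × SDual Λ L) × (L' × SDual Λ L')) :
    (hypSumEquiv e x).2 (hypSumEquiv e y).1 = x.1.2 y.1.1 + x.2.2 y.2.1 := by
  simp [hypSumEquiv]

/-- The hyperbolic pairs of `L` and `L'` add up to the one of `L ⊕ L'`. -/
noncomputable def hypPairSumIso (e : (L × L') ≃ₗ[Λ] L'') :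
    FlipPair.Iso ((hypPair Λ ε L).sum (hypPair Λ ε L')) (hypPair Λ ε L'') :=
  .of (.of (z := (hypBoundary Λ ε L).sum (hypBoundary Λ ε L')) (w := hypBoundary Λ ε L'')
      (hypSumEquiv e) (hypSumEquiv e) (fun _ => rfl)
      (fun x y => by
        rw [hypBoundary_μ, hypSumEquiv_snd_fst, hypSumEquiv_snd_fst]
        show _ = (hypBoundary Λ ε L).μ x.1 y.1 + (hypBoundary Λ ε L').μ x.2 y.2
        rw [hypBoundary_μ, hypBoundary_μ, star_add, smul_add]
        abel)
      (by
        show QGrp.oplus (QGrp.mk _ _) (QGrp.mk _ _) = QGrp.map _ (QGrp.mk _ _)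
        rw [QGrp.oplus, QGrp.map_mk, QGrp.map_mk, QGrp.map_mk, ← map_add]
        congr 1
        refine LinearMap.ext fun x => SDual.ext fun y => ?_
        exact (hypSumEquiv_snd_fst e x y).symm))
    (fun x y => by
      show hypFlipα Λ ε L'' (hypSumEquiv e x) (hypSumEquiv e y)
        = hypFlipα Λ ε L x.1 y.1 + hypFlipα Λ ε L' x.2 y.2
      rw [hypFlipα_apply, hypFlipα_apply, hypFlipα_apply, hypSumEquiv_snd_fst, hypSumEquiv_snd_fst,
        star_add, smul_add]
      abel)
    (fun x => by
      show hypFlipβ Λ L'' (hypSumEquiv e x)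
        = hypSumEquiv e (hypFlipβ Λ L x.1, hypFlipβ Λ L' x.2)
      refine Prod.ext rfl ?_
      ext y
      simp [hypSumEquiv, hypFlipβ_apply, add_comm])
    (by
      rw [FlipPair.sum_ν (hypPair Λ ε L).t (hypPair Λ ε L').t]
      show (0 : QGrp Λ (-ε) (SDual Λ (L'' × SDual Λ L''))) = QGrp.map _ (QGrp.map _ 0 + QGrp.map _ 0)
      rw [map_zero, map_zero, add_zero, map_zero])

instance [Subsingleton L] : Subsingleton (SDual Λ L) :=
  ⟨fun f g => SDual.ext fun x => by rw [Subsingleton.elim x 0, map_zero, map_zero]⟩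

/-- The zero pair is hyperbolic. -/
noncomputable def hypPairZeroIso [Subsingleton L] :
    FlipPair.Iso (FlipPair.zero : FlipPair Λ ε) (hypPair Λ ε L) :=
  .of (.of (z := SplitPreformation.zero) (w := hypBoundary Λ ε L)
      (LinearEquiv.ofSubsingleton PUnit.{u + 1} (L × SDual Λ L))
      (LinearEquiv.ofSubsingleton PUnit.{u + 1} (L × SDual Λ L))
      (fun _ => Subsingleton.elim _ _)
      (fun x y => by
        rw [Subsingleton.elim x 0, map_zero, map_zero, map_zero])
      (by
        show (0 : QGrp Λ (-ε) PUnit.{u + 1}) = QGrp.map _ (QGrp.mk _ _)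
        rw [QGrp.map_mk, ← map_zero (QGrp.mk (-ε))]
        congr 1))
    (fun x y => by
      rw [Subsingleton.elim x 0, map_zero, map_zero, map_zero])
    (fun _ => Subsingleton.elim _ _)
    (by
      show (0 : QGrp Λ (-ε) (SDual Λ (L × SDual Λ L))) = QGrp.map _ 0
      rw [map_zero])

end Hyperbolic

/-- The submonoid of the classes of boundaries of hyperbolic forms `H_{-ε}(L)`. -/
noncomputable def SplitPreformation.hyperbolic (Λ : Type u) [Ring Λ] [StarRing Λ] (ε : ℤˣ) :
    AddSubmonoid (SplitPreformation.IsoClass Λ ε) where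
  carrier := {a | ∃ (L : Type u) (_ : AddCommGroup L) (_ : Module Λ L) (_ : Module.Free Λ L)
    (_ : Module.Finite Λ L), a = (hypBoundary Λ ε L).toClass}
  zero_mem' := ⟨PUnit.{u + 1}, inferInstance, inferInstance, inferInstance, inferInstance,
    SplitPreformation.toClass_eq.2 ⟨hypPairZeroIso.toStrong⟩⟩
  add_mem' := by
    rintro _ _ ⟨L, _, _, _, _, rfl⟩ ⟨L', _, _, _, _, rfl⟩
    exact ⟨L × L', inferInstance, inferInstance, inferInstance, inferInstance,
      SplitPreformation.toClass_eq.2 ⟨(hypPairSumIso (LinearEquiv.refl Λ (L × L'))).toStrong⟩⟩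

/-- The submonoid of the classes of the pairs `(yᵏ, tᵏ)`, `yᵏ` the boundary of `H_{-ε}(Λᵏ)`. -/
noncomputable def FlipPair.hyperbolic (Λ : Type u) [Ring Λ] [StarRing Λ] (ε : ℤˣ) :
    AddSubmonoid (FlipPair.IsoClass Λ ε) where
  carrier := {a | ∃ k : ℕ, a = (hypPair Λ ε (Fin k → Λ)).toClass}
  zero_mem' := ⟨0, FlipPair.toClass_eq.2 ⟨hypPairZeroIso⟩⟩
  add_mem' := by
    rintro _ _ ⟨k, rfl⟩ ⟨l, rfl⟩
    exact ⟨k + l, FlipPair.toClass_eq.2 ⟨hypPairSumIso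
      ((LinearEquiv.sumArrowLequivProdArrow (Fin k) (Fin l) Λ Λ).symm.trans
        (LinearEquiv.funCongrLeft Λ Λ finSumFinEquiv.symm))⟩⟩

/-- The monoid `l_{2q+2}(Λ)` (for `ε = (-1)^q`): stable strong isomorphism classes of regular
`ε`-quadratic split preformations. -/
def LMonoid (Λ : Type u) [Ring Λ] [StarRing Λ] (ε : ℤˣ) : Type (u + 1) :=
  (stabCon (SplitPreformation.hyperbolic Λ ε)).Quotient

noncomputable instance : AddCommMonoid (LMonoid Λ ε) :=
  inferInstanceAs (AddCommMonoid (stabCon (SplitPreformation.hyperbolic Λ ε)).Quotient)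

/-- Passage from strong isomorphism classes to stable ones. -/
noncomputable def LMonoid.proj (Λ : Type u) [Ring Λ] [StarRing Λ] (ε : ℤˣ) :
    SplitPreformation.IsoClass Λ ε →+ LMonoid Λ ε :=
  (stabCon (SplitPreformation.hyperbolic Λ ε)).mk'

/-- The class `[z] ∈ l_{2q+2}(Λ)`. -/
noncomputable def LMonoid.mk (z : SplitPreformation Λ ε) : LMonoid Λ ε := LMonoid.proj Λ ε z.toClass

/-- The flip-`l`-monoid `fl_{2q+2}(Λ)` (for `ε = (-1)^q`): stable isomorphism classes of tuples
`(z, t)`. -/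
noncomputable def FLMonoid (Λ : Type u) [Ring Λ] [StarRing Λ] (ε : ℤˣ) : Type (u + 1) :=
  (stabCon (FlipPair.hyperbolic Λ ε)).Quotient

noncomputable instance : AddCommMonoid (FLMonoid Λ ε) :=
  inferInstanceAs (AddCommMonoid (stabCon (FlipPair.hyperbolic Λ ε)).Quotient)

/-- Passage from isomorphism classes of tuples to stable ones. -/
noncomputable def FLMonoid.proj (Λ : Type u) [Ring Λ] [StarRing Λ] (ε : ℤˣ) :
    FlipPair.IsoClass Λ ε →+ FLMonoid Λ ε :=
  (stabCon (FlipPair.hyperbolic Λ ε)).mk'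

/-- The class `[(z, t)] ∈ fl_{2q+2}(Λ)`. -/
noncomputable def FLMonoid.mk (a : FlipPair Λ ε) : FLMonoid Λ ε := FLMonoid.proj Λ ε a.toClass

/-- Forgetting the flip-isomorphism, on isomorphism classes. -/
noncomputable def FlipPair.forget (Λ : Type u) [Ring Λ] [StarRing Λ] (ε : ℤˣ) :
    FlipPair.IsoClass Λ ε →+ SplitPreformation.IsoClass Λ ε where
  toFun := Quotient.map FlipPair.z (fun _ _ ⟨f⟩ => ⟨f.toStrong⟩)
  map_zero' := rfl
  map_add' := by
    rintro ⟨a⟩ ⟨b⟩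
    rfl

/-- The homomorphism `π : fl_{2q+2}(Λ) → l_{2q+2}(Λ)`, `[(z, t)] ↦ [z]`. -/
noncomputable def FLMonoid.π (Λ : Type u) [Ring Λ] [StarRing Λ] (ε : ℤˣ) : FLMonoid Λ ε →+ LMonoid Λ ε :=
  stabLift (FlipPair.hyperbolic Λ ε) ((LMonoid.proj Λ ε).comp (FlipPair.forget Λ ε)) (by
    rintro _ ⟨k, rfl⟩
    exact stabMk_eq_zero (H := SplitPreformation.hyperbolic Λ ε)
      ⟨Fin k → Λ, inferInstance, inferInstance, inferInstance, inferInstance, rfl⟩)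

theorem FLMonoid.π_mk (a : FlipPair Λ ε) : FLMonoid.π Λ ε (FLMonoid.mk a) = LMonoid.mk a.z := rfl

/-- The set `l̃_{2q+2}(Λ)` of the classes `[z]` of the non-singular split formations `z` which have
a stable flip-isomorphism, that is, a flip-isomorphism of `z + h` for the boundary `h` of some
hyperbolic form. -/
def lTilde (Λ : Type u) [Ring Λ] [StarRing Λ] (ε : ℤˣ) : Set (LMonoid Λ ε) :=
  {a | ∃ z : SplitPreformation Λ ε, z.IsNonsingularFormation ∧ a = LMonoid.mk z ∧
    ∃ (L : Type u) (_ : AddCommGroup L) (_ : Module Λ L) (_ : Module.Free Λ L)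
      (_ : Module.Finite Λ L), Nonempty (FlipIso (z.sum (hypBoundary Λ ε L)))}

end Monoids

section AsymmetricSignature

variable {Λ : Type u} [Ring Λ] [StarRing Λ] {ε : ℤˣ}

open SplitPreformation

/-- The map
`ρ = [0 0 α; 1 0 -ε; 0 1 εα(ν* - εν)α*] : F ⊕ F* ⊕ F → (F ⊕ F* ⊕ F)* = F* ⊕ F ⊕ F*`. -/
noncomputable def asymMap (z : SplitPreformation Λ ε) (t : FlipIso z) :
    (z.F × SDual Λ z.F × z.F) →ₗ[Λ] SDual Λ (z.F × SDual Λ z.F × z.F) :=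
  let p₁ := LinearMap.fst Λ z.F (SDual Λ z.F × z.F)
  let p₂ := LinearMap.fst Λ (SDual Λ z.F) z.F ∘ₗ LinearMap.snd Λ z.F (SDual Λ z.F × z.F)
  let p₃ := LinearMap.snd Λ (SDual Λ z.F) z.F ∘ₗ LinearMap.snd Λ z.F (SDual Λ z.F × z.F)
  let α : z.F →ₗ[Λ] SDual Λ z.F := t.α.toLinearMap
  dualMap p₁ ∘ₗ α ∘ₗ p₃
    + dualMap p₂ ∘ₗ ev ∘ₗ p₁ - dualMap p₂ ∘ₗ (ε • ev) ∘ₗ p₃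
    + dualMap p₃ ∘ₗ p₂ + dualMap p₃ ∘ₗ (ε • (α ∘ₗ QGrp.toMap t.ν ∘ₗ adj α)) ∘ₗ p₃

theorem asymMap_apply' (z : SplitPreformation Λ ε) (t : FlipIso z)
    (m n : z.F × SDual Λ z.F × z.F) :
    asymMap z t m n = t.α m.2.2 n.1 + star (n.2.1 m.1) - ε • star (n.2.1 m.2.2)
      + m.2.1 n.2.2 + ε • t.α (QGrp.toMap t.ν (adj t.α.toLinearMap m.2.2)) n.2.2 := by
  simp [asymMap]

theorem asymMap_apply (z : SplitPreformation Λ ε) (t : FlipIso z)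
    (m n : z.F × SDual Λ z.F × z.F) :
    asymMap z t m n = t.α m.2.2 n.1 + star (n.2.1 m.1) - ε • star (n.2.1 m.2.2)
      + m.2.1 n.2.2 - QGrp.sym (-ε) t.ν (adj t.α.toLinearMap m.2.2)
        (adj t.α.toLinearMap n.2.2) := by
  rw [asymMap_apply', sub_eq_add_neg (_ + _)]
  have h : ∀ x : z.F, t.α x n.2.2 = star (adj (t.α.toLinearMap : z.F →ₗ[Λ] SDual Λ z.F) n.2.2 x) :=
    fun x => by simp
  rw [h, QGrp.apply_toMap, QGrp.sym_symm]
  rcases Int.units_eq_one_or ε with rfl | rfl <;> simp [sub_eq_add_neg]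

theorem asymMap_bijective (z : SplitPreformation Λ ε) (t : FlipIso z) :
    Function.Bijective (asymMap z t) := by
  constructor
  · rw [injective_iff_map_eq_zero]
    rintro ⟨x, f, y⟩ h
    have h' : ∀ n, asymMap z t (x, f, y) n = 0 := fun n => by rw [h]; rfl
    have hy : y = 0 := by
      apply t.α.injective
      rw [map_zero]
      refine SDual.ext fun a => ?_
      simpa [asymMap_apply'] using h' (a, 0, 0)
    subst hy
    have hx : x = 0 := by
      apply sdual_separates (Λ := Λ)
      intro g
      simpa [asymMap_apply'] using h' (0, g, 0)
    subst hx
    have hf : f = 0 := by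
      ext a
      simpa [asymMap_apply'] using h' (0, 0, a)
    subst hf
    rfl
  · intro Φ
    obtain ⟨y, hy⟩ := t.α.surjective
      (dualMap (LinearMap.inl Λ z.F (SDual Λ z.F × z.F)) Φ)
    obtain ⟨x, hx⟩ := (ev_bijective (Λ := Λ) (M := z.F)).2
      (dualMap (LinearMap.inr Λ z.F (SDual Λ z.F × z.F) ∘ₗ LinearMap.inl Λ (SDual Λ z.F) z.F) Φ)
    refine ⟨(x + ε • y,
      dualMap (LinearMap.inr Λ z.F (SDual Λ z.F × z.F) ∘ₗ LinearMap.inr Λ (SDual Λ z.F) z.F) Φ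
        - ε • (show SDual Λ z.F from t.α (QGrp.toMap t.ν (adj t.α.toLinearMap y))), y), ?_⟩
    ext ⟨a, g, b⟩
    have hΦ : Φ (a, g, b) = Φ (a, 0, 0) + Φ (0, g, 0) + Φ (0, 0, b) := by
      rw [← map_add, ← map_add]; simp
    have h1 : t.α y a = Φ (a, 0, 0) := congrArg (fun f : SDual Λ z.F => f a) hy
    have h2 : star (g x) = Φ (0, g, 0) :=
      congrArg (fun f : SDual Λ (SDual Λ z.F) => f g) hx
    rw [asymMap_apply', hΦ, ← h1, ← h2]
    have hg : g (ε • y) = ε • g y := by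
      rcases Int.units_eq_one_or ε with rfl | rfl <;> simp
    simp only [map_add, star_add, hg, star_units_smul, SDual.sub_apply, SDual.units_smul_apply,
      dualMap_apply, LinearMap.comp_apply, LinearMap.inr_apply]
    abel

/-- The non-singular asymmetric form `(F ⊕ F* ⊕ F, ρ)` of a flip-isomorphism. -/
noncomputable abbrev asymForm (z : SplitPreformation Λ ε) (t : FlipIso z) : AsymForm Λ where
  M := z.F × SDual Λ z.F × z.F
  form := asymMap z t
  nonsingular := asymMap_bijective z t

/-- The asymmetric signature `σ*(z, t) ∈ LAsy⁰(Λ)` of a flip-isomorphism `t` of `z`. -/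
noncomputable def asymSig (z : SplitPreformation Λ ε) (t : FlipIso z) : LAsy0 Λ :=
  LAsy0.mk (asymForm z t)

theorem asymForm_iso {a b : FlipPair Λ ε} (f : FlipPair.Iso a b) :
    asymForm a.z a.t ≈ asymForm b.z b.t := by
  let η := f.toStrong.α
  let e' : SDual Λ a.z.F ≃ₗ[Λ] SDual Λ b.z.F :=
    LinearEquiv.ofLinearMap (dualMap η.symm.toLinearMap) (dualMap η.toLinearMap)
      (by ext g x; simp) (by ext g x; simp)
  refine AsymForm.equiv_of (η.prodCongr (e'.prodCongr η)) ?_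
  rintro ⟨x, g, y⟩ ⟨x', g', y'⟩
  have e1 : ∀ (g : SDual Λ a.z.F) (x : a.z.F), e' g (η x) = g x := fun g x =>
    congrArg g (η.symm_apply_apply x)
  have e2 : ∀ y : a.z.F, dualMap η.toLinearMap (adj b.t.α.toLinearMap (η y))
      = adj a.t.α.toLinearMap y := fun y => SDual.ext fun x => congrArg star (f.apply_α x y)
  show asymMap a.z a.t (x, g, y) (x', g', y')
    = asymMap b.z b.t (η x, e' g, η y) (η x', e' g', η y')
  rw [asymMap_apply, asymMap_apply]
  simp only [e1]
  rw [f.comm_ν, QGrp.sym_map_apply]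
  have h1 := f.apply_α y x'
  have h2 := e2 y
  have h3 := e2 y'
  simp only [η] at h2 h3 ⊢
  rw [h1, h2, h3]

/-- Rearrangement of summands. -/
def asymSumEquiv (A B : Type u) [AddCommGroup A] [Module Λ A] [AddCommGroup B] [Module Λ B] :
    ((A × B) × SDual Λ (A × B) × (A × B)) ≃ₗ[Λ]
      ((A × SDual Λ A × A) × (B × SDual Λ B × B)) where
  toFun m := ((m.1.1, (dualSum.symm m.2.1).1, m.2.2.1), (m.1.2, (dualSum.symm m.2.1).2, m.2.2.2))
  map_add' m n := rfl
  map_smul' c m := rfl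
  invFun n := ((n.1.1, n.2.1), dualSum (n.1.2.1, n.2.2.1), (n.1.2.2, n.2.2.2))
  left_inv m := by simp
  right_inv n := by simp

theorem asymForm_sum (a b : FlipPair Λ ε) :
    asymForm (a.sum b).z (a.sum b).t ≈ (asymForm a.z a.t).sum (asymForm b.z b.t) := by
  refine AsymForm.equiv_of (asymSumEquiv a.z.F b.z.F) ?_
  rintro ⟨⟨x₁, x₂⟩, g, ⟨y₁, y₂⟩⟩ ⟨⟨x₁', x₂'⟩, g', ⟨y₁', y₂'⟩⟩
  obtain ⟨⟨g₁, g₂⟩, rfl⟩ := dualSum.surjective g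
  obtain ⟨⟨g₁', g₂'⟩, rfl⟩ := dualSum.surjective g'
  show asymMap (a.z.sum b.z) (FlipIso.sum a.t b.t) _ _
    = asymMap a.z a.t (x₁, (dualSum.symm (dualSum (g₁, g₂))).1, y₁)
        (x₁', (dualSum.symm (dualSum (g₁', g₂'))).1, y₁')
      + asymMap b.z b.t (x₂, (dualSum.symm (dualSum (g₁, g₂))).2, y₂)
        (x₂', (dualSum.symm (dualSum (g₁', g₂'))).2, y₂')
  rw [dualSum.symm_apply_apply, dualSum.symm_apply_apply]
  rw [asymMap_apply, asymMap_apply, asymMap_apply, FlipPair.sum_ν a.t b.t, map_add]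
  have e1 : ∀ y : a.z.F × b.z.F, dualMap (LinearMap.inl Λ a.z.F b.z.F)
      (adj (FlipIso.sum a.t b.t).α.toLinearMap y) = adj a.t.α.toLinearMap y.1 := fun y => by
    refine SDual.ext fun x => congrArg star ?_
    show a.t.α x y.1 + b.t.α 0 y.2 = a.t.α x y.1
    rw [map_zero]; exact add_zero _
  have e2 : ∀ y : a.z.F × b.z.F, dualMap (LinearMap.inr Λ a.z.F b.z.F)
      (adj (FlipIso.sum a.t b.t).α.toLinearMap y) = adj b.t.α.toLinearMap y.2 := fun y => by
    refine SDual.ext fun x => congrArg star ?_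
    show a.t.α 0 y.1 + b.t.α x y.2 = b.t.α x y.2
    rw [map_zero]; exact zero_add _
  rw [LinearMap.add_apply, SDual.add_apply, QGrp.sym_map_apply, QGrp.sym_map_apply]
  simp only [e1, e2, dualSum_apply, star_add, smul_add]
  have e3 : (FlipIso.sum a.t b.t).α (y₁, y₂) (x₁', x₂') = a.t.α y₁ x₁' + b.t.α y₂ x₂' := rfl
  rw [e3]
  abel

theorem asymForm_hypPair (L : Type u) [AddCommGroup L] [Module Λ L] [Module.Free Λ L]
    [Module.Finite Λ L] : (asymForm (hypPair Λ ε L).z (hypPair Λ ε L).t).IsMetabolic := by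
  let H := L × SDual Λ L
  let p : H →ₗ[Λ] L := LinearMap.fst Λ L (SDual Λ L)
  let q : H →ₗ[Λ] SDual Λ L := LinearMap.snd Λ L (SDual Λ L)
  let π₁ := LinearMap.fst Λ H (SDual Λ H × H)
  let π₂ := LinearMap.fst Λ (SDual Λ H) H ∘ₗ LinearMap.snd Λ H (SDual Λ H × H)
  let π₃ := LinearMap.snd Λ (SDual Λ H) H ∘ₗ LinearMap.snd Λ H (SDual Λ H × H)
  let i := LinearMap.inl Λ L (SDual Λ L)
  let j := LinearMap.inr Λ L (SDual Λ L)
  let A : (H × SDual Λ H × H) →ₗ[Λ] (SDual Λ L × SDual Λ L × SDual Λ L) :=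
    (q ∘ₗ π₁).prod ((dualMap i ∘ₗ π₂).prod (q ∘ₗ π₃))
  let B : (H × SDual Λ H × H) →ₗ[Λ] (L × SDual Λ (SDual Λ L) × L) :=
    (p ∘ₗ π₁).prod ((dualMap j ∘ₗ π₂).prod (p ∘ₗ π₃))
  have hA : ∀ m, m ∈ LinearMap.ker A ↔ m.1.2 = 0 ∧ (∀ a : L, m.2.1 (a, 0) = 0) ∧ m.2.2.2 = 0 := by
    intro m
    rw [LinearMap.mem_ker]
    constructor
    · intro h
      exact ⟨congrArg Prod.fst h, fun a =>
        congrArg (fun w : SDual Λ L × SDual Λ L × SDual Λ L => w.2.1 a) h,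
        congrArg (fun w : SDual Λ L × SDual Λ L × SDual Λ L => w.2.2) h⟩
    · rintro ⟨h1, h2, h3⟩
      exact Prod.ext h1 (Prod.ext (SDual.ext h2) h3)
  have hform : ∀ m n, (asymForm (hypPair Λ ε L).z (hypPair Λ ε L).t).form m n
      = ((-ε) • m.2.2.2 n.1.1 - star (n.1.2 m.2.2.1)) + star (n.2.1 m.1)
        - ε • star (n.2.1 m.2.2) + m.2.1 n.2.2 := by
    intro m n
    have h := asymMap_apply (hypPair Λ ε L).z (hypPair Λ ε L).t m n
    have h0 : (hypPair Λ ε L).t.ν = 0 := rfl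
    have h1 : (hypPair Λ ε L).t.α m.2.2 n.1 = (-ε) • m.2.2.2 n.1.1 - star (n.1.2 m.2.2.1) :=
      hypFlipα_apply Λ ε L _ _
    rw [h0, map_zero, LinearMap.zero_apply, SDual.zero_apply, sub_zero, h1] at h
    exact h
  refine ⟨LinearMap.ker A, ⟨LinearMap.ker B, ?_⟩, ?_⟩
  · constructor
    · rw [Submodule.disjoint_def]
      intro m h1 h2
      obtain ⟨h3, h4, h5⟩ := (hA m).1 h1
      have h2 : B m = 0 := h2
      have h6 : m.1.1 = 0 := congrArg Prod.fst h2
      have h7 : ∀ f : SDual Λ L, m.2.1 (0, f) = 0 := fun f =>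
        congrArg (fun w : L × SDual Λ (SDual Λ L) × L => w.2.1 f) h2
      have h8 : m.2.2.1 = 0 := congrArg (fun w : L × SDual Λ (SDual Λ L) × L => w.2.2) h2
      refine Prod.ext (Prod.ext h6 h3) (Prod.ext (SDual.ext fun x => ?_) (Prod.ext h8 h5))
      have : x = (x.1, 0) + (0, x.2) := by simp
      rw [this, map_add, h4, h7]; simp
    · rw [codisjoint_iff, eq_top_iff]
      rintro ⟨x, g, y⟩ -
      refine Submodule.mem_sup.2
        ⟨((x.1, 0), dualMap (j ∘ₗ q) g, (y.1, 0)), (hA _).2 ⟨rfl, fun a => ?_, rfl⟩,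
          ((0, x.2), dualMap (i ∘ₗ p) g, (0, y.2)), ?_, ?_⟩
      · exact map_zero g
      · refine Prod.ext rfl (Prod.ext (SDual.ext fun f => ?_) rfl)
        exact map_zero g
      · refine Prod.ext (by simp) (Prod.ext (SDual.ext fun w => ?_) (by simp))
        show g (0, w.2) + g (w.1, 0) = g w
        rw [← map_add]; simp
  · intro m
    constructor
    · intro hm n hn
      obtain ⟨a1, a2, a3⟩ := (hA m).1 hm
      obtain ⟨b1, b2, b3⟩ := (hA n).1 hn
      have c1 : m.1 = (m.1.1, 0) := Prod.ext rfl a1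
      have c2 : m.2.2 = (m.2.2.1, 0) := Prod.ext rfl a3
      have c3 : n.2.2 = (n.2.2.1, 0) := Prod.ext rfl b3
      rw [hform, c3, a2, c1, b2, c2, b2, b1]
      simp
    · intro h
      rw [hA]
      have h3 : m.2.2.2 = 0 := by
        ext a
        have h' := h ((a, 0), 0, 0) ((hA _).2 ⟨rfl, fun _ => rfl, rfl⟩)
        rw [hform] at h'
        rcases Int.units_eq_one_or ε with rfl | rfl <;> simpa using h'
      refine ⟨?_, fun a => ?_, h3⟩
      · apply sdual_separates (Λ := Λ)
        intro Ψ
        have h' := h (0, dualMap q Ψ, 0) ((hA _).2 ⟨rfl, fun a => map_zero Ψ, rfl⟩)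
        rw [hform] at h'
        simpa [q, h3] using h'
      · have h' := h (0, 0, (a, 0)) ((hA _).2 ⟨rfl, fun _ => rfl, rfl⟩)
        rw [hform] at h'
        simpa using h'

/-- The asymmetric signature on isomorphism classes of tuples. -/
noncomputable def asymSigClass (Λ : Type u) [Ring Λ] [StarRing Λ] (ε : ℤˣ) :
    FlipPair.IsoClass Λ ε →+ LAsy0 Λ where
  toFun := Quotient.lift (fun a : FlipPair Λ ε => asymSig a.z a.t) (by
    rintro a b ⟨f⟩
    exact congrArg (LAsy0.proj Λ) (AsymForm.toClass_eq.2 (asymForm_iso f)))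
  map_zero' := by
    have h : (FlipPair.zero : FlipPair Λ ε).toClass
        = (hypPair Λ ε (Fin 0 → Λ)).toClass := FlipPair.toClass_eq.2 ⟨hypPairZeroIso⟩
    show Quotient.lift _ _ (FlipPair.zero : FlipPair Λ ε).toClass = 0
    rw [h]
    exact LAsy0.mk_eq_zero (asymForm_hypPair _)
  map_add' := by
    rintro ⟨a⟩ ⟨b⟩
    exact (congrArg (LAsy0.proj Λ) (AsymForm.toClass_eq.2 (asymForm_sum a b))).trans
      ((LAsy0.proj Λ).map_add (asymForm a.z a.t).toClass (asymForm b.z b.t).toClass)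

/-- The homomorphism `σ* : fl_{2q+2}(Λ) → LAsy⁰(Λ)`, `[(z, t)] ↦ σ*(z, t)`. -/
noncomputable def asymSigHom (Λ : Type u) [Ring Λ] [StarRing Λ] (ε : ℤˣ) :
    FLMonoid Λ ε →+ LAsy0 Λ :=
  stabLift (FlipPair.hyperbolic Λ ε) (asymSigClass Λ ε) (by
    rintro _ ⟨k, rfl⟩
    exact LAsy0.mk_eq_zero (asymForm_hypPair _))

theorem asymSigHom_mk (a : FlipPair Λ ε) :
    asymSigHom Λ ε (FLMonoid.mk a) = asymSig a.z a.t := rfl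

end AsymmetricSignature

end Preform

/-! A non-singular formation is a lagrangian G of H = F ⊕ F*, with Φ the symmetrized hyperbolic
form. A flip-isomorphism t = (α, β, ν) is encoded by the isometry U = [0 α^{-*}; εα εα(ν-εν*)*] of
H: its first two equations say that U restricts to β on G, and U carries F onto F* whatever t is.
The form ρ remembers t only through U. Pulled back along a surjection H ⊕ H → F ⊕ F* ⊕ F which kills
all (q, q + Uq) with q in F, it becomes b(c, c₁) - Φ(Ut, c₁ - t₁) - Φ(c - t, t₁), where b(x, y) =
x.2 y.1 is the same for all t (`FlipIso.proj_graph`, `FlipIso.asymMap_proj`). Two flip-isomorphisms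
thus give isometries U, U' which both preserve G and agree on F up to an automorphism of F; this is
the data of `TwistPair`.

For the resulting forms X, X' it must be shown that X ⊕ -X' vanishes in the Witt group. Map n = (t,
t', c, f) to the class of (t, c + f) in X and that of (t', c) in X'. The b-terms cancel, and X ⊕ -X'
takes the value -ζ(n, n₁), where ζ is a form on H⁴ made of Φ, U and U' alone. Let Φ⁴ be Φ on each
summand of H⁴ and let W be given by Φ⁴(Wx, y) = ζ(x, y); then S satisfies Φ⁴(Sv, Wx) = -ζ(v, x). On
the metabolic form Y = [ζ Φ⁴; -Φ⁴S 0] the vectors (n - g, Wg) with g in G⁴ pair to ζ(n, n₁) - ζ(g,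
g₁), and ζ(g, g₁) = 0 because G is isotropic and preserved by U and U'. Hence the vectors (image of
n, n - g, Wg) form an isotropic submodule of X ⊕ -X' ⊕ Y. It is a direct summand
(`TwistPair.retrG_inclW`) and equals its annihilator (`TwistPair.exists_param`), so X and X' have
the same class (`TwistPair.mk_eq_mk`).

The induced map is then formal. Two elements of the flip monoid over the same [z] become, after
adding hyperbolic pairs, two flip-isomorphisms of one formation z + h, which is again non-singular;
these additions do not change the signature. Every element of the submonoid lifts to the flip
monoid, which gives existence and uniqueness. -/

namespace Preform

/-! ### Block forms with a vanishing diagonal block -/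

section BlockForm

variable {Λ : Type u} [Ring Λ] [StarRing Λ]
variable {V : Type u} [AddCommGroup V] [Module Λ V] {W : Type u} [AddCommGroup W] [Module Λ W]

/-- The map `[ζ ψ; χ 0] : V ⊕ W → (V ⊕ W)*`. -/
def blockMap (ζ : V →ₗ[Λ] SDual Λ V) (ψ : W →ₗ[Λ] SDual Λ V) (χ : V →ₗ[Λ] SDual Λ W) :
    (V × W) →ₗ[Λ] SDual Λ (V × W) :=
  dualSum.toLinearMap ∘ₗ
    (ζ ∘ₗ LinearMap.fst Λ V W + ψ ∘ₗ LinearMap.snd Λ V W).prod (χ ∘ₗ LinearMap.fst Λ V W)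

@[simp] theorem blockMap_apply (ζ : V →ₗ[Λ] SDual Λ V) (ψ : W →ₗ[Λ] SDual Λ V)
    (χ : V →ₗ[Λ] SDual Λ W) (x y : V × W) :
    blockMap ζ ψ χ x y = ζ x.1 y.1 + ψ x.2 y.1 + χ x.1 y.2 := rfl

theorem blockMap_bijective (ζ : V →ₗ[Λ] SDual Λ V) {ψ : W →ₗ[Λ] SDual Λ V}
    {χ : V →ₗ[Λ] SDual Λ W} (hψ : Function.Bijective ψ) (hχ : Function.Bijective χ) :
    Function.Bijective (blockMap ζ ψ χ) := by
  refine dualSum.bijective.comp ⟨?_, ?_⟩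
  · rw [injective_iff_map_eq_zero]
    rintro ⟨v, w⟩ h
    have h1 : χ v = 0 := congrArg Prod.snd h
    obtain rfl : v = 0 := hχ.1 (h1.trans (map_zero χ).symm)
    have h2 : ζ 0 + ψ w = 0 := congrArg Prod.fst h
    rw [map_zero, zero_add] at h2
    obtain rfl : w = 0 := hψ.1 (h2.trans (map_zero ψ).symm)
    rfl
  · rintro ⟨f, g⟩
    obtain ⟨v, rfl⟩ := hχ.2 g
    obtain ⟨w, hw⟩ := hψ.2 (f - ζ v)
    refine ⟨(v, w), Prod.ext ?_ rfl⟩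
    show ζ v + ψ w = f
    rw [hw, add_sub_cancel]

/-- The non-singular asymmetric form `[ζ ψ; χ 0]` on `V ⊕ W`. -/
abbrev blockForm [Module.Free Λ V] [Module.Finite Λ V] [Module.Free Λ W] [Module.Finite Λ W]
    (ζ : V →ₗ[Λ] SDual Λ V) (ψ : W →ₗ[Λ] SDual Λ V) (χ : V →ₗ[Λ] SDual Λ W)
    (hψ : Function.Bijective ψ) (hχ : Function.Bijective χ) : AsymForm Λ where
  M := V × W
  form := blockMap ζ ψ χ
  nonsingular := blockMap_bijective ζ hψ hχ

/-- The summand W is a lagrangian: the zero block makes it isotropic, and injectivity of χ forces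
the annihilator of W into W. -/
theorem blockForm_isMetabolic [Module.Free Λ V] [Module.Finite Λ V] [Module.Free Λ W]
    [Module.Finite Λ W] (ζ : V →ₗ[Λ] SDual Λ V) (ψ : W →ₗ[Λ] SDual Λ V)
    (χ : V →ₗ[Λ] SDual Λ W) (hψ : Function.Bijective ψ) (hχ : Function.Bijective χ) :
    (blockForm ζ ψ χ hψ hχ).IsMetabolic := by
  refine ⟨Submodule.prod ⊥ ⊤, ⟨Submodule.prod ⊤ ⊥, ?_⟩, ?_⟩
  · constructor
    · rw [disjoint_iff, Submodule.prod_inf_prod, bot_inf_eq, top_inf_eq, Submodule.prod_bot]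
    · rw [codisjoint_iff, Submodule.prod_sup_prod, bot_sup_eq, top_sup_eq, Submodule.prod_top]
  · rintro ⟨v, w⟩
    constructor
    · rintro ⟨hv, -⟩ ⟨v', w'⟩ ⟨hv', -⟩
      obtain rfl : v = 0 := hv
      obtain rfl : v' = 0 := hv'
      show ζ 0 0 + ψ w 0 + χ 0 w' = 0
      simp
    · intro h
      refine ⟨hχ.1 (SDual.ext fun w' => ?_), trivial⟩
      have h' : ζ v 0 + ψ w 0 + χ v w' = 0 := h (0, w') ⟨rfl, trivial⟩
      simpa using h'

/-- The orthogonal sum of two maps to the dual modules. -/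
def orthSum (φ : V →ₗ[Λ] SDual Λ V) (ψ : W →ₗ[Λ] SDual Λ W) : (V × W) →ₗ[Λ] SDual Λ (V × W) :=
  dualSum.toLinearMap ∘ₗ φ.prodMap ψ

@[simp] theorem orthSum_apply (φ : V →ₗ[Λ] SDual Λ V) (ψ : W →ₗ[Λ] SDual Λ W) (x y : V × W) :
    orthSum φ ψ x y = φ x.1 y.1 + ψ x.2 y.2 := rfl

theorem orthSum_bijective {φ : V →ₗ[Λ] SDual Λ V} {ψ : W →ₗ[Λ] SDual Λ W}
    (hφ : Function.Bijective φ) (hψ : Function.Bijective ψ) :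
    Function.Bijective (orthSum φ ψ) :=
  dualSum.bijective.comp ⟨Function.Injective.prodMap hφ.1 hψ.1, Function.Surjective.prodMap hφ.2 hψ.2⟩

end BlockForm

/-! ### Lagrangians and equality in the Witt group -/

section Lagrangians

variable {Λ : Type u} [Ring Λ] [StarRing Λ]

/-- A sufficient criterion for the range of a map to be a lagrangian. -/
theorem AsymForm.isMetabolic_of_retraction (A : AsymForm Λ) {E : Type u} [AddCommGroup E]
    [Module Λ E] (i : E →ₗ[Λ] A.M) (r : A.M →ₗ[Λ] E) (hr : ∀ e, r (i e) = e)
    (h0 : ∀ e e', A.form (i e) (i e') = 0)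
    (h1 : ∀ x, (∀ e, A.form x (i e) = 0) → ∃ e, i e = x) : A.IsMetabolic := by
  refine ⟨LinearMap.range i, ⟨LinearMap.ker r, ?_⟩, fun x => ⟨?_, fun h => ?_⟩⟩
  · constructor
    · rw [Submodule.disjoint_def]
      rintro _ ⟨e, rfl⟩ he
      have he : r (i e) = 0 := he
      rw [hr] at he
      rw [he, map_zero]
    · rw [codisjoint_iff, eq_top_iff]
      intro x _
      refine Submodule.mem_sup.2 ⟨i (r x), ⟨_, rfl⟩, x - i (r x), ?_, by abel⟩
      rw [LinearMap.mem_ker, map_sub, hr, sub_self]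
  · rintro ⟨e, rfl⟩ _ ⟨e', rfl⟩
    exact h0 e e'
  · exact h1 x fun e => h _ ⟨e, rfl⟩

theorem LAsy0.mk_sum (A B : AsymForm Λ) : LAsy0.mk (A.sum B) = LAsy0.mk A + LAsy0.mk B :=
  (LAsy0.proj Λ).map_add A.toClass B.toClass

theorem LAsy0.mk_neg (A : AsymForm Λ) : LAsy0.mk A.neg = -LAsy0.mk A := rfl

/-- The form -B represents the inverse of B, and Y represents zero. The freedom in choosing Y is
what makes room for a lagrangian. -/
theorem LAsy0.mk_eq_of_isMetabolic {A B Y : AsymForm Λ} (hY : Y.IsMetabolic)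
    (h : ((A.sum B.neg).sum Y).IsMetabolic) : LAsy0.mk A = LAsy0.mk B := by
  have h' := LAsy0.mk_eq_zero h
  rw [LAsy0.mk_sum, LAsy0.mk_sum, LAsy0.mk_eq_zero hY, LAsy0.mk_neg, add_zero] at h'
  exact add_neg_eq_zero.1 h'

end Lagrangians

/-! ### Forms twisted by two isometries which preserve a common lagrangian -/

section TwistedForms

variable {Λ : Type u} [Ring Λ] [StarRing Λ]

/-- Here v = (t, t', c, δ) is the shifted vector n - g with g = (a, b, y, d) in G⁴. The first four
lines are -ζ(n, n₁), the next two are ζ(v, v₁), and the last three are Φ⁴(Wg, v₁) - Φ⁴(Sv, Wg₁),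
which equals ζ(g, v₁) + ζ(v, g₁). The sum is -ζ(g, g₁), in which only products of elements of G
occur. The element z plays the part of U'⁻¹Uδ. -/
theorem isotropy_identity {H : Type u} [AddCommGroup H] [Module Λ H]
    (Φ : H →ₗ[Λ] SDual Λ H) (U U' : H ≃ₗ[Λ] H)
    (hU : ∀ x y, Φ (U x) (U y) = Φ x y) (hU' : ∀ x y, Φ (U' x) (U' y) = Φ x y)
    (G : Set H) (hG : ∀ x ∈ G, ∀ y ∈ G, Φ x y = 0)
    (hUG : ∀ x ∈ G, U x ∈ G) (hUG' : ∀ x ∈ G, U' x ∈ G)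
    {t t' c δ z a b y d t₁ t'₁ c₁ δ₁ a₁ b₁ y₁ d₁ : H}
    (ha : a ∈ G) (hb : b ∈ G) (hy : y ∈ G) (hd : d ∈ G)
    (ha₁ : a₁ ∈ G) (hb₁ : b₁ ∈ G) (hy₁ : y₁ ∈ G) (hd₁ : d₁ ∈ G) (hz : U δ = U' z) :
    Φ (c + y) (δ₁ + d₁)
      - Φ (U (t + a)) (c₁ + y₁ + (δ₁ + d₁) - (t₁ + a₁))
      - Φ (c + y + (δ + d) - (t + a)) (t₁ + a₁)
      + Φ (U' (t' + b)) (c₁ + y₁ - (t'₁ + b₁)) + Φ (c + y - (t' + b)) (t'₁ + b₁)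
      + (Φ (U t) (c₁ + δ₁ - t₁) - Φ c δ₁ + Φ (c + δ - t) t₁
        - Φ (U' t') (c₁ - t'₁) - Φ (c - t') t'₁)
      + (Φ (y + d - a - U a) t₁ + Φ (b + U' b - y) t'₁ + Φ (U a - U' b) c₁ + Φ (U a - y) δ₁)
      - (Φ (c - U t) (y₁ + d₁ - a₁ - U a₁) + Φ (c - U' t' - z) (b₁ + U' b₁ - y₁)
        + Φ (c - U δ - z) (U a₁ - U' b₁) + Φ z (U a₁ - y₁)) = 0 := by
  -- The only term that mixes the two isometries; it is what makes U'⁻¹U appear in `S`.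
  have e1 : Φ (U δ) (U' b₁) = Φ z b₁ := by rw [hz, hU']
  have n1 := hG _ hy _ hd₁
  have n2 := hG _ (hUG _ ha) _ hy₁
  have n3 := hG _ (hUG _ ha) _ hd₁
  have n4 := hG _ (hUG _ ha) _ ha₁
  have n5 := hG _ hy _ ha₁
  have n6 := hG _ hd _ ha₁
  have n7 := hG _ ha _ ha₁
  have n8 := hG _ (hUG' _ hb) _ hy₁
  have n9 := hG _ (hUG' _ hb) _ hb₁
  have n10 := hG _ hy _ hb₁
  have n11 := hG _ hb _ hb₁
  simp only [map_add, map_sub, SDual.add_apply, SDual.sub_apply, hU, hU', e1, n1, n2, n3, n4, n5, n6,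
    n7, n8, n9, n10, n11]
  abel

variable (Λ) in
/-- Two isometries `U`, `U'` of a non-singular form `(H, Φ)`, which map the lagrangian `G` to
itself and the lagrangian `F` to the same complement of `F`. -/
structure TwistPair (H F G : Type u) [AddCommGroup H] [Module Λ H] [AddCommGroup F] [Module Λ F]
    [AddCommGroup G] [Module Λ G] where
  Φ : H →ₗ[Λ] SDual Λ H
  bijective : Function.Bijective Φ
  U : H ≃ₗ[Λ] H
  U' : H ≃ₗ[Λ] H
  isometry : ∀ x y, Φ (U x) (U y) = Φ x y
  isometry' : ∀ x y, Φ (U' x) (U' y) = Φ x y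
  κ : F →ₗ[Λ] H
  κRetraction : H →ₗ[Λ] F
  κRetraction_κ : ∀ f, κRetraction (κ f) = f
  κ_perp : ∀ x, (∀ f, Φ x (κ f) = 0) → ∃ f, κ f = x
  k : F ≃ₗ[Λ] F
  U_κ : ∀ q, U (κ q) = U' (κ (k q))
  decomp : ∀ x, ∃ q f, x = U (κ q) + κ f
  ι : G →ₗ[Λ] H
  ιRetraction : H →ₗ[Λ] G
  ιRetraction_ι : ∀ g, ιRetraction (ι g) = g
  ι_isotropic : ∀ g g', Φ (ι g) (ι g') = 0
  ι_perp : ∀ x, (∀ g, Φ x (ι g) = 0) → ∃ g, ι g = x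
  β : G ≃ₗ[Λ] G
  β' : G ≃ₗ[Λ] G
  U_ι : ∀ g, U (ι g) = ι (β g)
  U'_ι : ∀ g, U' (ι g) = ι (β' g)

namespace TwistPair

variable {H F G : Type u} [AddCommGroup H] [Module Λ H] [AddCommGroup F] [Module Λ F]
  [AddCommGroup G] [Module Λ G] (D : TwistPair Λ H F G)

/-- The automorphism `U'⁻¹ U`. -/
def V : H ≃ₗ[Λ] H := D.U.trans D.U'.symm

theorem U'_V (x : H) : D.U' (D.V x) = D.U x := D.U'.apply_symm_apply (D.U x)

theorem V_κ (q : F) : D.V (D.κ q) = D.κ (D.k q) := by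
  apply D.U'.injective
  rw [U'_V, U_κ]

/-- The form `Φ` on each summand of `H⁴`. -/
def Φ4 : (H × H × H × H) →ₗ[Λ] SDual Λ (H × H × H × H) :=
  orthSum D.Φ (orthSum D.Φ (orthSum D.Φ D.Φ))

theorem Φ4_apply (v w : H × H × H × H) :
    D.Φ4 v w = D.Φ v.1 w.1 + D.Φ v.2.1 w.2.1 + D.Φ v.2.2.1 w.2.2.1 + D.Φ v.2.2.2 w.2.2.2 := by
  simp [Φ4, add_assoc]

theorem Φ4_bijective : Function.Bijective D.Φ4 :=
  orthSum_bijective D.bijective (orthSum_bijective D.bijective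
    (orthSum_bijective D.bijective D.bijective))

/-- The monodromy of the auxiliary form. -/
def S : (H × H × H × H) ≃ₗ[Λ] (H × H × H × H) where
  toFun v := (v.2.2.1 - D.U v.1, v.2.2.1 - D.U' v.2.1 - D.V v.2.2.2,
    v.2.2.1 - D.U v.2.2.2 - D.V v.2.2.2, D.V v.2.2.2)
  map_add' v w := by
    ext <;> simp <;> abel
  map_smul' a v := by
    ext <;> simp [smul_sub]
  invFun w :=
    -- The system is triangular: the last entry gives δ, then the third gives c, and the first two
    -- give t and t'.
    let δ := D.V.symm w.2.2.2
    let c := w.2.2.1 + D.U δ + w.2.2.2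
    (D.U.symm (c - w.1), D.U'.symm (c - w.2.2.2 - w.2.1), c, δ)
  left_inv v := by
    ext <;> simp <;> abel
  right_inv w := by
    ext <;> simp
    abel

/-- The entries are dictated by Φ⁴(Sv, Wx) = -ζ(v, x), where W is defined by Φ⁴(Wx, y) = ζ(x, y).
This makes the vectors (v, 0) of the auxiliary form left orthogonal to the vectors (-x, Wx). -/
theorem S_apply (v : H × H × H × H) : D.S v = (v.2.2.1 - D.U v.1,
    v.2.2.1 - D.U' v.2.1 - D.V v.2.2.2, v.2.2.1 - D.U v.2.2.2 - D.V v.2.2.2, D.V v.2.2.2) := rfl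

/-- The quadratic part of the auxiliary form. -/
def ζ : (H × H × H × H) →ₗ[Λ] SDual Λ (H × H × H × H) :=
  let p₁ := LinearMap.fst Λ H (H × H × H)
  let p₂ := LinearMap.fst Λ H (H × H) ∘ₗ LinearMap.snd Λ H (H × H × H)
  let p₃ := LinearMap.fst Λ H H ∘ₗ LinearMap.snd Λ H (H × H) ∘ₗ LinearMap.snd Λ H (H × H × H)
  let p₄ := LinearMap.snd Λ H H ∘ₗ LinearMap.snd Λ H (H × H) ∘ₗ LinearMap.snd Λ H (H × H × H)
  let U : H →ₗ[Λ] H := D.U.toLinearMap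
  let U' : H →ₗ[Λ] H := D.U'.toLinearMap
  dualMap (p₃ + p₄ - p₁) ∘ₗ D.Φ ∘ₗ U ∘ₗ p₁ - dualMap p₄ ∘ₗ D.Φ ∘ₗ p₃
    + dualMap p₁ ∘ₗ D.Φ ∘ₗ (p₃ + p₄ - p₁) - dualMap (p₃ - p₂) ∘ₗ D.Φ ∘ₗ U' ∘ₗ p₂
    - dualMap p₂ ∘ₗ D.Φ ∘ₗ (p₃ - p₂)

/-- For v and w with last entry in F this is the negative of what remains of X ⊕ -X' on the
parameters (t, t', c, f) once the terms in b have cancelled. -/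
theorem ζ_apply (v w : H × H × H × H) :
    D.ζ v w = D.Φ (D.U v.1) (w.2.2.1 + w.2.2.2 - w.1) - D.Φ v.2.2.1 w.2.2.2
      + D.Φ (v.2.2.1 + v.2.2.2 - v.1) w.1 - D.Φ (D.U' v.2.1) (w.2.2.1 - w.2.1)
      - D.Φ (v.2.2.1 - v.2.1) w.2.1 := rfl

variable [Module.Free Λ H] [Module.Finite Λ H]

theorem neg_Φ4_S_bijective : Function.Bijective (-(D.Φ4 ∘ₗ D.S.toLinearMap)) :=
  (Equiv.neg (SDual Λ (H × H × H × H))).bijective.comp (D.Φ4_bijective.comp D.S.bijective)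

/-- The auxiliary metabolic form. -/
abbrev auxForm : AsymForm Λ :=
  blockForm D.ζ D.Φ4 (-(D.Φ4 ∘ₗ D.S.toLinearMap)) D.Φ4_bijective D.neg_Φ4_S_bijective

theorem auxForm_apply (x y : (H × H × H × H) × (H × H × H × H)) :
    D.auxForm.form x y = D.ζ x.1 y.1 + D.Φ4 x.2 y.1 - D.Φ4 (D.S x.1) y.2 := by
  rw [sub_eq_add_neg]
  rfl

/-- The coordinates `(t, t', c, f, a, b, y, d)` of the lagrangian. -/
abbrev Param (H F G : Type u) : Type u := (H × H × H × F) × (G × G × G × G)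

/-- The component of the lagrangian in the first summand of the auxiliary form. -/
def inclV : Param H F G →ₗ[Λ] (H × H × H × H) where
  toFun e := (e.1.1 - D.ι e.2.1, e.1.2.1 - D.ι e.2.2.1, e.1.2.2.1 - D.ι e.2.2.2.1,
    D.κ e.1.2.2.2 - D.ι e.2.2.2.2)
  map_add' e e' := by ext <;> simp <;> abel
  map_smul' a e := by ext <;> simp [smul_sub]

/-- The component of the lagrangian in the second summand of the auxiliary form. -/
def inclW : Param H F G →ₗ[Λ] (H × H × H × H) where
  toFun e := (D.ι e.2.2.2.1 + D.ι e.2.2.2.2 - D.ι e.2.1 - D.U (D.ι e.2.1),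
    D.ι e.2.2.1 + D.U' (D.ι e.2.2.1) - D.ι e.2.2.2.1,
    D.U (D.ι e.2.1) - D.U' (D.ι e.2.2.1), D.U (D.ι e.2.1) - D.ι e.2.2.2.1)
  map_add' e e' := by ext <;> simp <;> abel
  map_smul' a e := by ext <;> simp [smul_sub]

theorem inclV_apply (t t' c : H) (f : F) (a b y d : G) : D.inclV ((t, t', c, f), (a, b, y, d)) =
    (t - D.ι a, t' - D.ι b, c - D.ι y, D.κ f - D.ι d) := rfl

/-- This is Wx for x = (ιa, ιb, ιy, ιd): pairing it with any vector under Φ⁴ gives the value of ζ at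
x and that vector. It compensates for the shift by -x in `inclV`. -/
theorem inclW_apply (n : H × H × H × F) (a b y d : G) : D.inclW (n, (a, b, y, d)) =
    (D.ι y + D.ι d - D.ι a - D.U (D.ι a), D.ι b + D.U' (D.ι b) - D.ι y,
      D.U (D.ι a) - D.U' (D.ι b), D.U (D.ι a) - D.ι y) := rfl

/-- Recovery of `(a, b, y, d)` from the second component. -/
def retrG : (H × H × H × H) →ₗ[Λ] (G × G × G × G) :=
  let r := D.ιRetraction
  let p₁ := LinearMap.fst Λ H (H × H × H)
  let p₂ := LinearMap.fst Λ H (H × H) ∘ₗ LinearMap.snd Λ H (H × H × H)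
  let p₃ := LinearMap.fst Λ H H ∘ₗ LinearMap.snd Λ H (H × H) ∘ₗ LinearMap.snd Λ H (H × H × H)
  let p₄ := LinearMap.snd Λ H H ∘ₗ LinearMap.snd Λ H (H × H) ∘ₗ LinearMap.snd Λ H (H × H × H)
  let b := r ∘ₗ (p₂ + p₃ - p₄)
  let y := r ∘ₗ (p₃ - p₄) + D.β'.toLinearMap ∘ₗ b
  let a := D.β.symm.toLinearMap ∘ₗ (r ∘ₗ p₄ + y)
  let d := r ∘ₗ p₁ - y + a + D.β.toLinearMap ∘ₗ a
  a.prod (b.prod (y.prod d))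

theorem retrG_apply (w : H × H × H × H) : D.retrG w =
    let b := D.ιRetraction (w.2.1 + w.2.2.1 - w.2.2.2)
    let y := D.ιRetraction (w.2.2.1 - w.2.2.2) + D.β' b
    let a := D.β.symm (D.ιRetraction w.2.2.2 + y)
    (a, b, y, D.ιRetraction w.1 - y + a + D.β a) := rfl

/-- Writing (A, B, C, E) for the four entries, B + C - E = ιb, C - E = ιy - U'ιb and E + ιy = Uιa,
so b, y, a and finally d are recovered in turn. This splits the inclusion of the future lagrangian:
once g is known, adding ιg to the `inclV` component returns n. -/
theorem retrG_inclW (e : Param H F G) : D.retrG (D.inclW e) = e.2 := by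
  obtain ⟨n, a, b, y, d⟩ := e
  have hb : D.ιRetraction (D.ι b + D.U' (D.ι b) - D.ι y + (D.U (D.ι a) - D.U' (D.ι b))
      - (D.U (D.ι a) - D.ι y)) = b := by
    rw [show D.ι b + D.U' (D.ι b) - D.ι y + (D.U (D.ι a) - D.U' (D.ι b))
      - (D.U (D.ι a) - D.ι y) = D.ι b by abel, D.ιRetraction_ι]
  have hy : D.ιRetraction (D.U (D.ι a) - D.U' (D.ι b) - (D.U (D.ι a) - D.ι y)) + D.β' b = y := by
    rw [show D.U (D.ι a) - D.U' (D.ι b) - (D.U (D.ι a) - D.ι y) = D.ι y - D.U' (D.ι b) by abel,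
      D.U'_ι, map_sub, D.ιRetraction_ι, D.ιRetraction_ι, sub_add_cancel]
  have ha : D.β.symm (D.ιRetraction (D.U (D.ι a) - D.ι y) + y) = a := by
    rw [D.U_ι, map_sub, D.ιRetraction_ι, D.ιRetraction_ι, sub_add_cancel,
      LinearEquiv.symm_apply_apply]
  have hd : D.ιRetraction (D.ι y + D.ι d - D.ι a - D.U (D.ι a)) - y + a + D.β a = d := by
    rw [D.U_ι, map_sub, map_sub, map_add]
    simp only [D.ιRetraction_ι]
    abel
  simp only [retrG_apply, inclW_apply, hb, hy, ha, hd]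

/-- The first five terms are the contribution of X ⊕ -X' with the two copies of b removed. -/
theorem aux_isotropic (e e' : Param H F G) :
    D.Φ e.1.2.2.1 (D.κ e'.1.2.2.2)
      - D.Φ (D.U e.1.1) (e'.1.2.2.1 + D.κ e'.1.2.2.2 - e'.1.1)
      - D.Φ (e.1.2.2.1 + D.κ e.1.2.2.2 - e.1.1) e'.1.1
      + D.Φ (D.U' e.1.2.1) (e'.1.2.2.1 - e'.1.2.1) + D.Φ (e.1.2.2.1 - e.1.2.1) e'.1.2.1
      + D.auxForm.form (D.inclV e, D.inclW e) (D.inclV e', D.inclW e') = 0 := by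
  obtain ⟨⟨t, t', c, f⟩, a, b, y, d⟩ := e
  obtain ⟨⟨t₁, t'₁, c₁, f₁⟩, a₁, b₁, y₁, d₁⟩ := e'
  have h := isotropy_identity D.Φ D.U D.U' D.isometry D.isometry' (Set.range D.ι)
    (by rintro _ ⟨g, rfl⟩ _ ⟨g', rfl⟩; exact D.ι_isotropic g g')
    (by rintro _ ⟨g, rfl⟩; exact ⟨_, (D.U_ι g).symm⟩)
    (by rintro _ ⟨g, rfl⟩; exact ⟨_, (D.U'_ι g).symm⟩)
    (t := t - D.ι a) (t' := t' - D.ι b) (c := c - D.ι y) (δ := D.κ f - D.ι d)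
    (z := D.V (D.κ f - D.ι d)) (t₁ := t₁ - D.ι a₁) (t'₁ := t'₁ - D.ι b₁) (c₁ := c₁ - D.ι y₁)
    (δ₁ := D.κ f₁ - D.ι d₁)
    ⟨a, rfl⟩ ⟨b, rfl⟩ ⟨y, rfl⟩ ⟨d, rfl⟩ ⟨a₁, rfl⟩ ⟨b₁, rfl⟩ ⟨y₁, rfl⟩ ⟨d₁, rfl⟩ (D.U'_V _).symm
  simp only [sub_add_cancel] at h
  rw [auxForm_apply, ζ_apply, Φ4_apply, Φ4_apply, S_apply]
  simp only [inclV_apply, inclW_apply]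
  rw [← h]
  abel

/-- Sorting by the entries of the second vector isolates the conditions for left orthogonality that
`exists_param` reads off one at a time. -/
theorem auxForm_mk (t t' c δ A B C E t₁ t'₁ c₁ δ₁ A₁ B₁ C₁ E₁ : H) :
    D.auxForm.form ((t, t', c, δ), (A, B, C, E)) ((t₁, t'₁, c₁, δ₁), (A₁, B₁, C₁, E₁))
      = D.Φ (A - (D.U t + t - c - δ)) t₁ + D.Φ (B - (c - t' - D.U' t')) t'₁
        + D.Φ (C - (D.U' t' - D.U t)) c₁ + D.Φ (E + D.U t - c) δ₁
        - (D.Φ (c - D.U t) A₁ + D.Φ (c - D.U' t' - D.V δ) B₁ + D.Φ (c - D.U δ - D.V δ) C₁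
          + D.Φ (D.V δ) E₁) := by
  rw [auxForm_apply, ζ_apply, Φ4_apply, Φ4_apply, S_apply]
  simp only [map_add, map_sub, SDual.add_apply, SDual.sub_apply]
  abel

/-- This is the maximality of the lagrangian for vectors without component in X ⊕ X'. Such a vector
must come from a parameter that dies in both X and X', which explains the special shape with q: it
makes the representatives in the two forms (κq, κq + Uκq) and (κ(kq), κ(kq) + U'κ(kq)). -/
theorem exists_param (v w : H × H × H × H)
    (h : ∀ e : Param H F G, D.auxForm.form (v, w) (D.inclV e, D.inclW e) = 0) :
    ∃ (q : F) (g : G × G × G × G),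
      D.inclV ((D.κ q, D.V (D.κ q), D.U (D.κ q) + D.V (D.κ q), q - D.k q), g) = v ∧
      D.inclW ((D.κ q, D.V (D.κ q), D.U (D.κ q) + D.V (D.κ q), q - D.k q), g) = w := by
  obtain ⟨t, t', c, δ⟩ := v
  obtain ⟨A, B, C, E⟩ := w
  have h' := fun (x₁ x₂ x₃ : H) (f : F) (a b y d : G) =>
    (D.auxForm_mk _ _ _ _ _ _ _ _ _ _ _ _ _ _ _ _).symm.trans (h ((x₁, x₂, x₃, f), (a, b, y, d)))
  have hsep : ∀ {x y : H}, (∀ z, D.Φ (x - y) z = 0) → x = y := fun hx =>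
    sub_eq_zero.1 (D.bijective.1 ((SDual.ext hx).trans (map_zero D.Φ).symm))
  -- The parameters t₁, t'₁, c₁ run over all of H, so nondegeneracy of Φ determines A, B and C
  -- completely.
  have hA : A = D.U t + t - c - δ := hsep fun x => by simpa using h' x 0 0 0 0 0 0 0
  have hB : B = c - t' - D.U' t' := hsep fun x => by simpa using h' 0 x 0 0 0 0 0 0
  have hC : C = D.U' t' - D.U t := hsep fun x => by simpa using h' 0 0 x 0 0 0 0 0
  -- The fourth parameter runs over F only, so E is determined just up to an element of F, its own
  -- annihilator. This k is an element of F, not the automorphism `D.k`.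
  obtain ⟨k, hk⟩ : ∃ f, D.κ f = E + D.U t - c :=
    D.κ_perp _ fun f => by simpa using h' 0 0 0 f 0 0 0 0
  -- The parameters in G now give four combinations annihilated by ι(G), hence lying in ι(G).
  have hg := fun a b y d => h' 0 0 0 0 a b y d
  simp only [← hk, ← hA, ← hB, ← hC, sub_self, map_zero, SDual.zero_apply, zero_sub, neg_zero,
    zero_add, map_neg] at hg
  obtain ⟨d, hd⟩ : ∃ g, D.ι g = c - D.U t + D.κ k := D.ι_perp _ fun g => by
    have h1 := hg 0 0 0 g
    simp only [map_zero, sub_zero, add_zero, zero_add] at h1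
    rw [map_add, SDual.add_apply, add_comm, ← neg_eq_zero, ← h1, neg_add']
  obtain ⟨y, hy⟩ : ∃ g, D.ι g = D.U' t' - D.U t := D.ι_perp _ fun g => by
    have h1 := hg 0 0 g 0
    simp only [map_zero, sub_zero, add_zero, zero_sub, map_neg, neg_zero, map_sub,
      SDual.sub_apply] at h1 ⊢
    rw [← neg_eq_zero, ← h1]
    abel
  obtain ⟨a, ha⟩ : ∃ g, D.ι g = D.U t - c + t - δ := D.ι_perp _ fun g => by
    have h1 := hg g 0 0 0
    simp only [map_zero, sub_zero, add_zero, zero_sub, map_neg, neg_zero, map_sub,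
      map_add, SDual.sub_apply, SDual.add_apply, D.isometry] at h1 ⊢
    rw [← neg_eq_zero, ← h1]
    abel
  have hV : ∀ x, D.Φ (D.U δ) (D.U' x) = D.Φ (D.V δ) x := fun x => by
    rw [← D.U'_V, D.isometry']
  obtain ⟨b, hb⟩ : ∃ g, D.ι g = c - D.U' t' - t' := D.ι_perp _ fun g => by
    have h1 := hg 0 g 0 0
    simp only [map_zero, sub_zero, add_zero, zero_add, zero_sub, map_neg, neg_zero, map_sub,
      map_add, SDual.sub_apply, D.isometry', hV] at h1 ⊢
    rw [← neg_eq_zero, ← h1]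
    abel
  -- With this q one has Vκq = -κk and U'κk = -Uκq, so modulo ι(G) the vector v depends on q alone.
  obtain ⟨q, hq⟩ : ∃ q, D.k q = -k := D.k.surjective _
  have hVq : D.V (D.κ q) = -D.κ k := by rw [V_κ, hq, map_neg]
  have hUk : D.U' (D.κ k) = -D.U (D.κ q) := by rw [← U'_V, hVq, map_neg, neg_neg]
  have hb' : t' = -D.κ k - D.ι (b + y - d) := by
    rw [map_sub, map_add, hb, hy, hd]; abel
  -- From Ut = U't' - ιy and the formula for t', the equation holds after applying U; invariance of
  -- ι(G) under U and U' allows it to be solved for t.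
  have ha' : t = D.κ q - D.ι (D.β.symm (y + D.β' (b + y - d))) := by
    apply D.U.injective
    rw [map_sub, D.U_ι, LinearEquiv.apply_symm_apply, map_add, ← D.U'_ι, hy, hb', map_sub, map_neg,
      hUk]
    abel
  set b' := b + y - d
  set a' := D.β.symm (y + D.β' b')
  have hy' : c = D.U (D.κ q) - D.κ k - D.ι (D.β a' - d) := by
    rw [map_sub, ← D.U_ι, hd, ha', map_sub]; abel
  have hd' : δ = D.κ q + D.κ k - D.ι (d + a' + a) := by
    rw [map_add, map_add, hd, ha, ha']; abel
  have hE : E = D.U (D.ι a') - D.ι (D.β a' - d) := by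
    have hk' : E = D.κ k + c - D.U t := by rw [hk]; abel
    rw [hk', hy', ha']
    simp only [map_sub]
    abel
  have hκ : D.κ (q - D.k q) = D.κ q + D.κ k := by rw [hq, sub_neg_eq_add, map_add]
  have hc : D.U (D.κ q) + D.V (D.κ q) = D.U (D.κ q) - D.κ k := by rw [hVq, ← sub_eq_add_neg]
  refine ⟨q, (a', b', D.β a' - d, d + a' + a), ?_, ?_⟩
  · rw [inclV_apply, hκ, hc, hVq, ← hd', ← hy', ← ha', ← hb']
  · rw [inclW_apply, hA, hB, hC, hE, hd', hy', hb', ha']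
    simp only [map_sub, map_neg, hUk]
    refine Prod.ext ?_ (Prod.ext ?_ (Prod.ext ?_ rfl)) <;> simp only <;> abel

/-- The same b occurs in both forms, so shifting c by an element κf' costs only Φ(c, κf') and b
cancels from X ⊕ -X'. What is left involves Φ, U and U' alone and is absorbed by `auxForm`. -/
theorem mk_eq_mk (X X' : AsymForm Λ) (b : H → H → Λ)
    (hb : ∀ x y f f', b (x + D.κ f) (y + D.κ f') = b x y + D.Φ x (D.κ f'))
    (τ : (H × H) →ₗ[Λ] X.M) (τ' : (H × H) →ₗ[Λ] X'.M)
    (hτ : Function.Surjective τ) (hτ' : Function.Surjective τ')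
    (hτ0 : ∀ q, τ (D.κ q, D.κ q + D.U (D.κ q)) = 0)
    (hτ0' : ∀ q, τ' (D.κ q, D.κ q + D.U' (D.κ q)) = 0)
    (hX : ∀ t c t₁ c₁, X.form (τ (t, c)) (τ (t₁, c₁))
      = b c c₁ - D.Φ (D.U t) (c₁ - t₁) - D.Φ (c - t) t₁)
    (hX' : ∀ t c t₁ c₁, X'.form (τ' (t, c)) (τ' (t₁, c₁))
      = b c c₁ - D.Φ (D.U' t) (c₁ - t₁) - D.Φ (c - t) t₁) :
    LAsy0.mk X = LAsy0.mk X' := by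
  refine LAsy0.mk_eq_of_isMetabolic (Y := D.auxForm) (blockForm_isMetabolic _ _ _ _ _) ?_
  let p₁ : Param H F G →ₗ[Λ] H := LinearMap.fst Λ H (H × H × F) ∘ₗ LinearMap.fst Λ _ _
  let p₂ : Param H F G →ₗ[Λ] H := LinearMap.fst Λ H (H × F) ∘ₗ LinearMap.snd Λ H (H × H × F)
    ∘ₗ LinearMap.fst Λ _ _
  let p₃ : Param H F G →ₗ[Λ] H := LinearMap.fst Λ H F ∘ₗ LinearMap.snd Λ H (H × F)
    ∘ₗ LinearMap.snd Λ H (H × H × F) ∘ₗ LinearMap.fst Λ _ _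
  let p₄ : Param H F G →ₗ[Λ] F := LinearMap.snd Λ H F ∘ₗ LinearMap.snd Λ H (H × F)
    ∘ₗ LinearMap.snd Λ H (H × H × F) ∘ₗ LinearMap.fst Λ _ _
  let a₁ : Param H F G →ₗ[Λ] X.M := τ ∘ₗ p₁.prod (p₃ + D.κ ∘ₗ p₄)
  let a₂ : Param H F G →ₗ[Λ] X'.M := τ' ∘ₗ p₂.prod p₃
  -- The lagrangian: X receives (t, c + κf) and X' receives (t', c), so the two second entries
  -- differ only by an element of F.
  let i : Param H F G →ₗ[Λ] ((X.M × X'.M) × (H × H × H × H) × (H × H × H × H)) :=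
    (a₁.prod a₂).prod (D.inclV.prod D.inclW)
  let T := (X.M × X'.M) × (H × H × H × H) × (H × H × H × H)
  let v : T →ₗ[Λ] (H × H × H × H) := LinearMap.fst Λ _ _ ∘ₗ LinearMap.snd Λ _ _
  let g : T →ₗ[Λ] (G × G × G × G) := D.retrG ∘ₗ LinearMap.snd Λ _ _ ∘ₗ LinearMap.snd Λ _ _
  let n : T →ₗ[Λ] (H × H × H × H) := v + (D.ι.prodMap (D.ι.prodMap (D.ι.prodMap D.ι))) ∘ₗ g
  let r : T →ₗ[Λ] Param H F G :=
    ((LinearMap.id.prodMap (LinearMap.id.prodMap (LinearMap.id.prodMap D.κRetraction))) ∘ₗ n).prod g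
  have hi : ∀ e : Param H F G, i e = ((τ (e.1.1, e.1.2.2.1 + D.κ e.1.2.2.2),
    τ' (e.1.2.1, e.1.2.2.1)), D.inclV e, D.inclW e) := fun e => rfl
  have hform : ∀ (x : T) (e : Param H F G), ((X.sum X'.neg).sum D.auxForm).form x (i e)
      = X.form x.1.1 (τ (e.1.1, e.1.2.2.1 + D.κ e.1.2.2.2))
        - X'.form x.1.2 (τ' (e.1.2.1, e.1.2.2.1))
        + D.auxForm.form x.2 (D.inclV e, D.inclW e) := fun x e => by
    rw [sub_eq_add_neg]; rfl
  have hiso : ∀ e e', ((X.sum X'.neg).sum D.auxForm).form (i e) (i e') = 0 := fun e e' => by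
    rw [hform, hi, hX, hX', hb, ← D.aux_isotropic e e']
    abel
  refine AsymForm.isMetabolic_of_retraction _ i r ?_ hiso ?_
  · intro e
    have hg : g (i e) = e.2 := D.retrG_inclW e
    have hv : v (i e) = D.inclV e := rfl
    obtain ⟨⟨t, t', c, f⟩, a, b, y, d⟩ := e
    show (((v (i _)).1 + D.ι (g (i _)).1, (v (i _)).2.1 + D.ι (g (i _)).2.1,
        (v (i _)).2.2.1 + D.ι (g (i _)).2.2.1,
        D.κRetraction ((v (i _)).2.2.2 + D.ι (g (i _)).2.2.2)), g (i _)) = _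
    rw [hg, hv, inclV_apply]
    simp only [sub_add_cancel, D.κRetraction_κ]
  · intro x hx
    -- Representatives (t, c) and (t', c') need not satisfy c - c' ∈ F. Since c' - c = Uκq + κf,
    -- adding (κq, κq + Uκq) from the kernel of τ to (t, c) moves its second entry to c' + κ(q - f).
    obtain ⟨e₀, h₁, h₂⟩ : ∃ e₀, (i e₀).1.1 = x.1.1 ∧ (i e₀).1.2 = x.1.2 := by
      obtain ⟨⟨t, c⟩, h₁⟩ := hτ x.1.1
      obtain ⟨⟨t', c'⟩, h₂⟩ := hτ' x.1.2
      obtain ⟨q, f, hqf⟩ := D.decomp (c' - c)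
      refine ⟨((t + D.κ q, t', c', q - f), 0), ?_, h₂⟩
      have hc : (t + D.κ q, c' + D.κ (q - f)) = (t, c) + (D.κ q, D.κ q + D.U (D.κ q)) := by
        refine Prod.ext rfl ?_
        show c' + D.κ (q - f) = c + (D.κ q + D.U (D.κ q))
        rw [map_sub, ← sub_eq_zero, ← sub_eq_zero.2 hqf]
        abel
      show τ (t + D.κ q, c' + D.κ (q - f)) = _
      rw [hc, map_add, hτ0, add_zero, h₁]
    -- Subtracting i e₀, which is orthogonal to the range of i by isotropy, leaves an orthogonal
    -- vector with components in the auxiliary summand only.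
    obtain ⟨q, g₀, hv, hw⟩ := D.exists_param (x.2.1 - D.inclV e₀) (x.2.2 - D.inclW e₀) fun e => by
      have h := sub_eq_zero.2 ((hx e).trans (hiso e₀ e).symm)
      rw [hform, hform, h₁, h₂, add_sub_add_left_eq_sub] at h
      have h' : (x.2.1 - D.inclV e₀, x.2.2 - D.inclW e₀) = x.2 - (i e₀).2 := rfl
      rw [h', map_sub, SDual.sub_apply, h]
    refine ⟨e₀ + ((D.κ q, D.V (D.κ q), D.U (D.κ q) + D.V (D.κ q), q - D.k q), g₀), ?_⟩
    rw [map_add, hi ((D.κ q, _), g₀), hv, hw]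
    -- Adding the correcting parameter must not disturb the components in X and X' already matched
    -- by e₀.
    have hz₁ : τ (D.κ q, D.U (D.κ q) + D.V (D.κ q) + D.κ (q - D.k q)) = 0 := by
      rw [← hτ0 q, V_κ, map_sub]
      congr 2
      abel
    have hz₂ : τ' (D.V (D.κ q), D.U (D.κ q) + D.V (D.κ q)) = 0 := by
      rw [← U'_V, V_κ, add_comm, hτ0']
    refine Prod.ext (Prod.ext ?_ ?_) ?_
    · exact (congrArg₂ (· + ·) h₁ hz₁).trans (add_zero _)
    · exact (congrArg₂ (· + ·) h₂ hz₂).trans (add_zero _)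
    · exact add_sub_cancel (i e₀).2 x.2


end TwistPair

end TwistedForms

/-! ### Flip-isomorphisms as isometries of the hyperbolic form -/

section FlipIsometries

open SplitPreformation

variable {Λ : Type u} [Ring Λ] [StarRing Λ] {ε : ℤˣ}

/-- The symmetrization of the hyperbolic form `H_ε(F)`. -/
def hypSym (Λ : Type u) [Ring Λ] [StarRing Λ] (ε : ℤˣ) (F : Type u) [AddCommGroup F] [Module Λ F] :
    (F × SDual Λ F) →ₗ[Λ] SDual Λ (F × SDual Λ F) :=
  QGrp.sym ε (hyp Λ ε F)

theorem hypSym_apply (F : Type u) [AddCommGroup F] [Module Λ F] (x y : F × SDual Λ F) :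
    hypSym Λ ε F x y = x.2 y.1 + ε • star (y.2 x.1) := by
  simp [hypSym, hyp]

theorem units_smul_eq_zero {M : Type*} [AddCommGroup M] {δ : ℤˣ} {x : M} : δ • x = 0 ↔ x = 0 := by
  rcases Int.units_eq_one_or δ with rfl | rfl <;> simp

theorem hypSym_bijective (F : Type u) [AddCommGroup F] [Module Λ F] [Module.Free Λ F]
    [Module.Finite Λ F] : Function.Bijective (hypSym Λ ε F) := by
  constructor
  · rw [injective_iff_map_eq_zero]
    intro x hx
    have h : ∀ y : F × SDual Λ F, x.2 y.1 + ε • star (y.2 x.1) = 0 := fun y => by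
      rw [← hypSym_apply, hx]; rfl
    refine Prod.ext (sdual_separates (Λ := Λ) fun f => ?_) (SDual.ext fun y => ?_)
    · have h' := h (0, f)
      simpa [units_smul_eq_zero] using h'
    · simpa using h (y, 0)
  · intro Ψ
    obtain ⟨x, hx⟩ := (ev_bijective (Λ := Λ) (M := F)).2 (dualMap (LinearMap.inr Λ F (SDual Λ F)) Ψ)
    refine ⟨(ε • x, dualMap (LinearMap.inl Λ F (SDual Λ F)) Ψ), SDual.ext fun y => ?_⟩
    have h : star (y.2 x) = Ψ (0, y.2) := congrArg (fun f : SDual Λ (SDual Λ F) => f y.2) hx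
    have hε : ε • star (y.2 (ε • x)) = star (y.2 x) := by
      rcases Int.units_eq_one_or ε with rfl | rfl <;> simp
    rw [hypSym_apply, hε, h]
    show Ψ (y.1, 0) + Ψ (0, y.2) = Ψ y
    rw [← map_add]; simp

variable {F : Type u} [AddCommGroup F] [Module Λ F] [Module.Free Λ F] [Module.Finite Λ F]

/-- The dual isomorphism `α* : F → F*` of an isomorphism `α : F → F*`. -/
noncomputable def adjEquiv (α : F ≃ₗ[Λ] SDual Λ F) : F ≃ₗ[Λ] SDual Λ F :=
  LinearEquiv.ofBijective (adj α.toLinearMap) (by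
    constructor
    · rw [injective_iff_map_eq_zero]
      intro x hx
      refine sdual_separates (Λ := Λ) fun f => ?_
      obtain ⟨y, rfl⟩ := α.surjective f
      have h : star (α y x) = 0 := congrArg (fun f : SDual Λ F => f y) hx
      rw [map_zero, ← star_eq_zero, h]
    · intro h
      obtain ⟨x, hx⟩ := (ev_bijective (Λ := Λ) (M := F)).2 (dualMap α.symm.toLinearMap h)
      refine ⟨x, SDual.ext fun y => ?_⟩
      have h' : star (α y x) = h (α.symm (α y)) :=
        congrArg (fun f : SDual Λ (SDual Λ F) => f (α y)) hx
      rwa [α.symm_apply_apply] at h')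

theorem apply_adjEquiv_symm (α : F ≃ₗ[Λ] SDual Λ F) (h : SDual Λ F) (x : F) :
    α x ((adjEquiv α).symm h) = star (h x) := by
  have e : star (α x ((adjEquiv α).symm h)) = h x :=
    congrArg (fun f : SDual Λ F => f x) ((adjEquiv α).apply_symm_apply h)
  rw [← e, star_star]

/-- The isometry `[0 α^{-*}; εα εαN]` of `H_ε(F)`. -/
noncomputable def flipIsometry (ε : ℤˣ) (α : F ≃ₗ[Λ] SDual Λ F) (N : SDual Λ F →ₗ[Λ] F) :
    (F × SDual Λ F) ≃ₗ[Λ] (F × SDual Λ F) where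
  toFun x := ((adjEquiv α).symm x.2, α (ε • (x.1 + N x.2)))
  map_add' x y := by
    refine Prod.ext (map_add _ _ _) ?_
    show α (ε • (x.1 + y.1 + N (x.2 + y.2))) = α (ε • (x.1 + N x.2)) + α (ε • (y.1 + N y.2))
    rw [← map_add, ← smul_add, map_add, add_add_add_comm]
  map_smul' a x := by
    refine Prod.ext (map_smul _ _ _) ?_
    show α (ε • (a • x.1 + N (a • x.2))) = a • α (ε • (x.1 + N x.2))
    rcases Int.units_eq_one_or ε with rfl | rfl <;> simp
  invFun y := (ε • α.symm y.2 - N (adjEquiv α y.1), adjEquiv α y.1)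
  left_inv x := by
    refine Prod.ext ?_ ((adjEquiv α).apply_symm_apply x.2)
    show ε • α.symm (α (ε • (x.1 + N x.2))) - N (adjEquiv α ((adjEquiv α).symm x.2)) = x.1
    rw [α.symm_apply_apply, LinearEquiv.apply_symm_apply, units_smul_self, add_sub_cancel_right]
  right_inv y := by
    refine Prod.ext ((adjEquiv α).symm_apply_apply y.1) ?_
    show α (ε • (ε • α.symm y.2 - N (adjEquiv α y.1) + N (adjEquiv α y.1))) = y.2
    rw [sub_add_cancel, units_smul_self, α.apply_symm_apply]

theorem flipIsometry_apply (α : F ≃ₗ[Λ] SDual Λ F) (N : SDual Λ F →ₗ[Λ] F) (x : F × SDual Λ F) :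
    flipIsometry ε α N x = ((adjEquiv α).symm x.2, α (ε • (x.1 + N x.2))) := rfl

theorem lin_units_smul {M N : Type u} [AddCommGroup M] [Module Λ M] [AddCommGroup N] [Module Λ N]
    (f : M ≃ₗ[Λ] N) (δ : ℤˣ) (x : M) : f (δ • x) = δ • f x := by
  rcases Int.units_eq_one_or δ with rfl | rfl <;> simp

/-- The symmetrization of ν is (-ε)-symmetric, so its two contributions to the ε-symmetric form
cancel; those of α and α^{-*} reproduce the hyperbolic pairing. -/
theorem flipIsometry_isometry (α : F ≃ₗ[Λ] SDual Λ F) (ν : QGrp Λ (-ε) (SDual Λ F))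
    (x y : F × SDual Λ F) :
    hypSym Λ ε F (flipIsometry ε α (QGrp.toMap ν) x) (flipIsometry ε α (QGrp.toMap ν) y)
      = hypSym Λ ε F x y := by
  rw [hypSym_apply, hypSym_apply, flipIsometry_apply, flipIsometry_apply, lin_units_smul,
    lin_units_smul]
  simp only [SDual.units_smul_apply, apply_adjEquiv_symm]
  rw [map_add, map_add, QGrp.apply_toMap, QGrp.apply_toMap, star_units_smul, star_star,
    star_add, QGrp.sym_symm]
  rcases Int.units_eq_one_or ε with rfl | rfl <;> simp <;> abel

/-- The equation for μ gives the F-component and the equation for γ the F*-component. -/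
theorem FlipIso.flipIsometry_incl {z : SplitPreformation Λ ε} (t : FlipIso z) (g : z.G) :
    flipIsometry ε t.α (QGrp.toMap t.ν) (z.γ.prod z.μ g) = z.γ.prod z.μ (t.β g) := by
  refine Prod.ext ?_ ?_
  · show (adjEquiv t.α).symm (z.μ g) = z.γ (t.β g)
    rw [LinearEquiv.symm_apply_eq]
    exact SDual.ext fun y => (FlipIso.apply_μ t g y).symm
  · show t.α (ε • (z.γ g + QGrp.toMap t.ν (z.μ g))) = z.μ (t.β g)
    rw [lin_units_smul t.α, map_add, FlipIso.apply_γ, units_smul_self]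

/-- The two isometries of `H_ε(F)` which belong to two flip-isomorphisms of a non-singular
formation, as a pair. -/
theorem SplitPreformation.IsNonsingularFormation.exists_twistPair {z : SplitPreformation Λ ε}
    (hz : z.IsNonsingularFormation) (t t' : FlipIso z) :
    ∃ D : TwistPair Λ (z.F × SDual Λ z.F) z.F z.G, D.Φ = hypSym Λ ε z.F ∧
      D.κ = LinearMap.inl Λ z.F (SDual Λ z.F) ∧
      D.U = flipIsometry ε t.α (QGrp.toMap t.ν) ∧ D.U' = flipIsometry ε t'.α (QGrp.toMap t'.ν) := by
  obtain ⟨hinj, ⟨K, hK⟩, h0, hker⟩ := hz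
  -- The range equals its own annihilator; this supplies both isotropy and maximality of G.
  have hmem : ∀ x, x ∈ LinearMap.range (z.γ.prod z.μ) ↔
      ∀ g, hypSym Λ ε z.F x (z.γ.prod z.μ g) = 0 := by
    intro x
    conv_lhs => rw [← hker]
    rw [LinearMap.mem_ker]
    constructor
    · intro h g
      exact congrArg (fun f : SDual Λ (LinearMap.range (z.γ.prod z.μ)) => f ⟨_, g, rfl⟩) h
    · intro h
      refine SDual.ext ?_
      rintro ⟨_, g, rfl⟩
      exact h g
  let e : z.G ≃ₗ[Λ] LinearMap.range (z.γ.prod z.μ) := LinearEquiv.ofInjective _ hinj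
  let P : (z.F × SDual Λ z.F) →ₗ[Λ] LinearMap.range (z.γ.prod z.μ) :=
    Submodule.projectionOnto _ K hK
  refine ⟨{
    Φ := hypSym Λ ε z.F
    bijective := hypSym_bijective z.F
    U := flipIsometry ε t.α (QGrp.toMap t.ν)
    U' := flipIsometry ε t'.α (QGrp.toMap t'.ν)
    isometry := flipIsometry_isometry t.α t.ν
    isometry' := flipIsometry_isometry t'.α t'.ν
    κ := LinearMap.inl Λ z.F (SDual Λ z.F)
    κRetraction := LinearMap.fst Λ z.F (SDual Λ z.F)
    κRetraction_κ := fun _ => rfl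
    κ_perp := fun x hx => ⟨x.1, Prod.ext rfl (SDual.ext fun f => ?_)⟩
    -- Both isometries send (q, 0) into F*, to (0, εαq) and (0, εα'q) respectively, so α'⁻¹α
    -- compares them.
    k := t.α.trans t'.α.symm
    U_κ := fun q => ?_
    decomp := fun x => ⟨ε • t.α.symm x.2, x.1, ?_⟩
    ι := z.γ.prod z.μ
    ιRetraction := e.symm.toLinearMap ∘ₗ P
    ιRetraction_ι := fun g => ?_
    ι_isotropic := fun g => (hmem _).1 ⟨g, rfl⟩
    ι_perp := fun x hx => (hmem x).2 hx
    β := t.β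
    β' := t'.β
    U_ι := FlipIso.flipIsometry_incl t
    U'_ι := FlipIso.flipIsometry_incl t' }, rfl, rfl, rfl, rfl⟩
  · have h := hx f
    rw [hypSym_apply] at h
    simpa using h.symm
  · rw [flipIsometry_apply, flipIsometry_apply]
    refine Prod.ext ?_ ?_
    · simp
    · simp
  · rw [flipIsometry_apply]
    refine Prod.ext ?_ ?_
    · simp
    · simp [units_smul_self]
  · show e.symm (P (z.γ.prod z.μ g)) = g
    rw [LinearEquiv.symm_apply_eq]
    exact Submodule.projectionOnto_apply_left hK (e g)

end FlipIsometries

/-! ### Independence of the signature from the flip-isomorphism -/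

section Comparison

open SplitPreformation

variable {Λ : Type u} [Ring Λ] [StarRing Λ] {ε : ℤˣ}

/-- The projection of `H × H`, `H = F ⊕ F*`, onto the module `F ⊕ F* ⊕ F` which carries the
asymmetric form of a flip-isomorphism. -/
noncomputable def FlipIso.proj {z : SplitPreformation Λ ε} (t : FlipIso z) :
    ((z.F × SDual Λ z.F) × (z.F × SDual Λ z.F)) →ₗ[Λ] z.F × SDual Λ z.F × z.F :=
  let H := z.F × SDual Λ z.F
  let tF := LinearMap.fst Λ z.F (SDual Λ z.F) ∘ₗ LinearMap.fst Λ H H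
  let tP := LinearMap.snd Λ z.F (SDual Λ z.F) ∘ₗ LinearMap.fst Λ H H
  let cF := LinearMap.fst Λ z.F (SDual Λ z.F) ∘ₗ LinearMap.snd Λ H H
  let cP := LinearMap.snd Λ z.F (SDual Λ z.F) ∘ₗ LinearMap.snd Λ H H
  let α : z.F →ₗ[Λ] SDual Λ z.F := t.α.toLinearMap
  (ε • ((adjEquiv t.α).symm.toLinearMap ∘ₗ tP - cF + tF)).prod
    (((ε • (α ∘ₗ QGrp.toMap t.ν ∘ₗ adj α)) ∘ₗ (cF - tF) + ε • (α ∘ₗ cF) - cP + tP).prod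
      (tF - cF))

theorem FlipIso.proj_apply {z : SplitPreformation Λ ε} (t : FlipIso z)
    (x c : z.F × SDual Λ z.F) :
    FlipIso.proj t (x, c) = (ε • ((adjEquiv t.α).symm x.2 - c.1 + x.1),
      ε • (t.α (QGrp.toMap t.ν (adj t.α.toLinearMap (c.1 - x.1))) : SDual Λ z.F)
        + ε • (t.α c.1 : SDual Λ z.F) - c.2 + x.2, x.1 - c.1) := rfl

theorem FlipIso.proj_surjective {z : SplitPreformation Λ ε} (t : FlipIso z) :
    Function.Surjective (FlipIso.proj t) := by
  rintro ⟨a, g, b⟩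
  -- Taking the F-part of c to be zero, the third coordinate fixes the F-part of the first vector,
  -- the first coordinate its F*-part, and the second coordinate the F*-part of c.
  refine ⟨((b, adjEquiv t.α (ε • a - b)), (0, adjEquiv t.α (ε • a - b) - g
    + ε • (t.α (QGrp.toMap t.ν (adj t.α.toLinearMap (0 - b))) : SDual Λ z.F))), ?_⟩
  rw [FlipIso.proj_apply]
  refine Prod.ext ?_ (Prod.ext ?_ (sub_zero b))
  · show ε • ((adjEquiv t.α).symm (adjEquiv t.α (ε • a - b)) - 0 + b) = a
    rw [LinearEquiv.symm_apply_apply, sub_zero, sub_add_cancel, units_smul_self]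
  · simp only [map_zero, smul_zero]
    abel

theorem FlipIso.proj_graph {z : SplitPreformation Λ ε} (t : FlipIso z) (f : z.F) :
    FlipIso.proj t (LinearMap.inl Λ z.F (SDual Λ z.F) f, LinearMap.inl Λ z.F (SDual Λ z.F) f
      + flipIsometry ε t.α (QGrp.toMap t.ν) (LinearMap.inl Λ z.F (SDual Λ z.F) f)) = 0 := by
  rw [FlipIso.proj_apply, flipIsometry_apply]
  refine Prod.ext ?_ (Prod.ext ?_ ?_)
  · simp
  · simp [lin_units_smul t.α]
  · simp

/-- After the pull back to H ⊕ H, t enters only through its isometry, and the term c.2 c₁.1 is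
common to all flip-isomorphisms of z. -/
theorem FlipIso.asymMap_proj {z : SplitPreformation Λ ε} (t : FlipIso z)
    (x c x₁ c₁ : z.F × SDual Λ z.F) :
    asymMap z t (FlipIso.proj t (x, c)) (FlipIso.proj t (x₁, c₁)) = c.2 c₁.1
      - hypSym Λ ε z.F (flipIsometry ε t.α (QGrp.toMap t.ν) x) (c₁ - x₁)
      - hypSym Λ ε z.F (c - x) x₁ := by
  have hsmul : ∀ (f : SDual Λ z.F) (y : z.F), f (ε • y) = ε • f y := fun f y => by
    rcases Int.units_eq_one_or ε with rfl | rfl <;> simp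
  -- The (-ε)-symmetry of the symmetrized ν moves it across the pairing at the price of the sign -ε.
  have hN : ∀ y : z.F, x.2 (QGrp.toMap t.ν (adj t.α.toLinearMap y))
      = -(ε • t.α (QGrp.toMap t.ν x.2) y) := fun y => by
    have h : t.α (QGrp.toMap t.ν x.2) y
        = star (adj (t.α.toLinearMap : z.F →ₗ[Λ] SDual Λ z.F) y (QGrp.toMap t.ν x.2)) := by simp
    rw [h, QGrp.apply_toMap, QGrp.apply_toMap, QGrp.sym_symm]
    rcases Int.units_eq_one_or ε with rfl | rfl <;> simp
  rw [FlipIso.proj_apply, FlipIso.proj_apply, asymMap_apply', hypSym_apply, hypSym_apply,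
    flipIsometry_apply, lin_units_smul t.α]
  have h1 : ∀ y h, t.α y ((adjEquiv t.α).symm h) = star (h y) := fun y h =>
    apply_adjEquiv_symm t.α h y
  simp only [hsmul, map_add, map_sub, SDual.add_apply, SDual.sub_apply, SDual.units_smul_apply,
    Prod.fst_sub, Prod.snd_sub, star_add, star_sub, star_units_smul, hN, h1, star_star, smul_add,
    smul_sub, units_smul_self]
  rcases Int.units_eq_one_or ε with rfl | rfl <;> simp <;> abel

theorem asymSig_eq_of_isNonsingularFormation {z : SplitPreformation Λ ε}
    (hz : z.IsNonsingularFormation) (t t' : FlipIso z) : asymSig z t = asymSig z t' := by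
  obtain ⟨D, hΦ, hκ, hU, hU'⟩ := hz.exists_twistPair t t'
  refine D.mk_eq_mk (asymForm z t) (asymForm z t') (fun x y => x.2 y.1) (fun x y f f' => ?_)
    (FlipIso.proj t) (FlipIso.proj t') (FlipIso.proj_surjective t) (FlipIso.proj_surjective t')
    (fun q => ?_) (fun q => ?_) (fun x c x₁ c₁ => ?_) (fun x c x₁ c₁ => ?_)
  · rw [hΦ, hκ, hypSym_apply]
    simp
  · rw [hκ, hU]
    exact FlipIso.proj_graph t q
  · rw [hκ, hU']
    exact FlipIso.proj_graph t' q
  · rw [hΦ, hU]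
    exact FlipIso.asymMap_proj t x c x₁ c₁
  · rw [hΦ, hU']
    exact FlipIso.asymMap_proj t' x c x₁ c₁

end Comparison

/-! ### Stability of non-singular formations and transport of flip-isomorphisms -/

section Formations

open SplitPreformation

variable {Λ : Type u} [Ring Λ] [StarRing Λ] {ε : ℤˣ}

/-- The pulled back form is γ*μ = θ - εθ*, which is (1 - T_ε) of a representative of θ. -/
theorem SplitPreformation.map_hyp (z : SplitPreformation Λ ε) :
    QGrp.map (z.γ.prod z.μ) (hyp Λ ε z.F) = 0 := by
  obtain ⟨φ, hφ⟩ := QGrp.mk_surjective (-ε) z.θ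
  rw [hyp, QGrp.map_mk]
  refine (QuotientAddGroup.eq_zero_iff _).2 ⟨φ, LinearMap.ext fun x => SDual.ext fun y => ?_⟩
  show φ x y - T ε φ x y = z.μ x (z.γ y)
  rw [← quadratic_apply, ← hφ, QGrp.sym_mk]
  simp [sub_eq_add_neg]

theorem SplitPreformation.hypSym_incl (z : SplitPreformation Λ ε) (g g' : z.G) :
    hypSym Λ ε z.F (z.γ.prod z.μ g) (z.γ.prod z.μ g') = 0 := by
  have h := congrArg (fun ψ => QGrp.sym ε ψ g g') z.map_hyp
  rw [QGrp.sym_map_apply, map_zero] at h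
  exact h

/-- Vanishing of the quadratic form is automatic in a preformation (`map_hyp`), so only a splitting
and maximality remain to be checked. -/
theorem SplitPreformation.isNonsingularFormation_of {z : SplitPreformation Λ ε}
    (r : (z.F × SDual Λ z.F) →ₗ[Λ] z.G) (hr : ∀ g, r (z.γ.prod z.μ g) = g)
    (hperp : ∀ x, (∀ g, hypSym Λ ε z.F x (z.γ.prod z.μ g) = 0) → ∃ g, z.γ.prod z.μ g = x) :
    z.IsNonsingularFormation := by
  refine ⟨Function.LeftInverse.injective hr, ⟨LinearMap.ker r, ?_⟩, ?_, ?_⟩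
  · constructor
    · rw [Submodule.disjoint_def]
      rintro _ ⟨g, rfl⟩ hg
      have h : g = 0 := (hr g).symm.trans hg
      rw [h, map_zero]
    · rw [codisjoint_iff, eq_top_iff]
      intro x _
      refine Submodule.mem_sup.2 ⟨z.γ.prod z.μ (r x), ⟨r x, rfl⟩, x - z.γ.prod z.μ (r x), ?_,
        add_sub_cancel _ _⟩
      rw [LinearMap.mem_ker, map_sub, hr, sub_self]
  · have h : (LinearMap.range (z.γ.prod z.μ)).subtype
        = z.γ.prod z.μ ∘ₗ r ∘ₗ (LinearMap.range (z.γ.prod z.μ)).subtype := by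
      refine LinearMap.ext ?_
      rintro ⟨_, g, rfl⟩
      show z.γ.prod z.μ g = z.γ.prod z.μ (r (z.γ.prod z.μ g))
      rw [hr]
    rw [h, ← QGrp.map_map, z.map_hyp, map_zero]
  · ext x
    rw [LinearMap.mem_ker]
    constructor
    · intro h
      exact hperp x fun g =>
        congrArg (fun f : SDual Λ (LinearMap.range (z.γ.prod z.μ)) => f ⟨_, g, rfl⟩) h
    · rintro ⟨g, rfl⟩
      refine SDual.ext ?_
      rintro ⟨_, g', rfl⟩
      exact z.hypSym_incl g g'

theorem SplitPreformation.IsNonsingularFormation.exists_retraction {z : SplitPreformation Λ ε}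
    (hz : z.IsNonsingularFormation) :
    ∃ r : (z.F × SDual Λ z.F) →ₗ[Λ] z.G, ∀ g, r (z.γ.prod z.μ g) = g := by
  obtain ⟨hinj, ⟨K, hK⟩, -⟩ := hz
  let e : z.G ≃ₗ[Λ] LinearMap.range (z.γ.prod z.μ) := LinearEquiv.ofInjective _ hinj
  refine ⟨e.symm.toLinearMap ∘ₗ Submodule.projectionOnto _ K hK, fun g => ?_⟩
  show e.symm (Submodule.projectionOnto _ K hK (e g)) = g
  rw [LinearEquiv.symm_apply_eq]
  exact Submodule.projectionOnto_apply_left hK (e g)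

theorem SplitPreformation.IsNonsingularFormation.exists_of_perp {z : SplitPreformation Λ ε}
    (hz : z.IsNonsingularFormation) {x : z.F × SDual Λ z.F}
    (hx : ∀ g, hypSym Λ ε z.F x (z.γ.prod z.μ g) = 0) : ∃ g, z.γ.prod z.μ g = x := by
  have h : x ∈ LinearMap.range (z.γ.prod z.μ) := by
    rw [← hz.2.2.2, LinearMap.mem_ker]
    refine SDual.ext ?_
    rintro ⟨_, g, rfl⟩
    exact hx g
  exact h

/-- The image is the graph of a (-ε)-symmetric map; orthogonality of x to this graph says exactly
that x lies on it. -/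
theorem hypBoundary_isNonsingularFormation (L : Type u) [AddCommGroup L] [Module Λ L]
    [Module.Free Λ L] [Module.Finite Λ L] : (hypBoundary Λ ε L).IsNonsingularFormation := by
  refine isNonsingularFormation_of (LinearMap.fst Λ _ _) (fun _ => rfl) fun x hx =>
    ⟨x.1, Prod.ext rfl (SDual.ext fun y => ?_)⟩
  have h : hypSym Λ ε _ x (y, QGrp.sym (-ε) (hyp Λ (-ε) L) y) = 0 := hx y
  rw [hypSym_apply, QGrp.sym_symm] at h
  show QGrp.sym (-ε) (hyp Λ (-ε) L) x.1 y = x.2 y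
  rw [eq_comm, ← sub_eq_zero]
  rcases Int.units_eq_one_or ε with rfl | rfl <;> simpa [sub_eq_add_neg] using h

theorem SplitPreformation.IsNonsingularFormation.sum {z w : SplitPreformation Λ ε}
    (hz : z.IsNonsingularFormation) (hw : w.IsNonsingularFormation) :
    (z.sum w).IsNonsingularFormation := by
  obtain ⟨r, hr⟩ := hz.exists_retraction
  obtain ⟨s, hs⟩ := hw.exists_retraction
  let i := LinearMap.inl Λ z.F w.F
  let j := LinearMap.inr Λ z.F w.F
  have hi : ∀ g, dualMap i ((z.sum w).μ g) = z.μ g.1 := fun g => SDual.ext fun x => by simp [i]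
  have hj : ∀ g, dualMap j ((z.sum w).μ g) = w.μ g.2 := fun g => SDual.ext fun x => by simp [j]
  refine isNonsingularFormation_of (z := z.sum w)
    ((r ∘ₗ (LinearMap.fst Λ z.F w.F).prodMap (dualMap i)).prod
      (s ∘ₗ (LinearMap.snd Λ z.F w.F).prodMap (dualMap j))) (fun g => Prod.ext ?_ ?_) ?_
  · show r (z.γ g.1, dualMap i ((z.sum w).μ g)) = g.1
    rw [hi]; exact hr g.1
  · show s (w.γ g.2, dualMap j ((z.sum w).μ g)) = g.2
    rw [hj]; exact hs g.2
  · intro x hx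
    obtain ⟨g, hg⟩ := hz.exists_of_perp (x := (x.1.1, dualMap i x.2)) fun g => by
      have h := hx (g, 0)
      rw [hypSym_apply] at h ⊢
      simpa [i] using h
    obtain ⟨g', hg'⟩ := hw.exists_of_perp (x := (x.1.2, dualMap j x.2)) fun g => by
      have h := hx (0, g)
      rw [hypSym_apply] at h ⊢
      simpa [j] using h
    have e3 : z.γ g = x.1.1 := congrArg Prod.fst hg
    have e4 : w.γ g' = x.1.2 := congrArg Prod.fst hg'
    refine ⟨(g, g'), Prod.ext (Prod.ext e3 e4) (SDual.ext fun y => ?_)⟩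
    have e1 : z.μ g = dualMap i x.2 := congrArg Prod.snd hg
    have e2 : w.μ g' = dualMap j x.2 := congrArg Prod.snd hg'
    show z.μ g y.1 + w.μ g' y.2 = x.2 y
    rw [e1, e2, dualMap_apply, dualMap_apply, ← map_add]
    simp [i, j]

theorem toMap_map_dualMap {M N : Type u} [AddCommGroup M] [Module Λ M] [Module.Free Λ M]
    [Module.Finite Λ M] [AddCommGroup N] [Module Λ N] [Module.Free Λ N] [Module.Finite Λ N]
    {δ : ℤˣ} (f : M →ₗ[Λ] N) (ν : QGrp Λ δ (SDual Λ M)) (g : SDual Λ N) :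
    QGrp.toMap (QGrp.map (dualMap f) ν) g = f (QGrp.toMap ν (dualMap f g)) := by
  apply sdual_separates (Λ := Λ)
  intro h
  rw [QGrp.apply_toMap, QGrp.sym_map_apply, ← QGrp.apply_toMap, dualMap_apply]

/-- The dual of an isomorphism. -/
def dualEquiv {M N : Type u} [AddCommGroup M] [Module Λ M] [AddCommGroup N] [Module Λ N]
    (e : M ≃ₗ[Λ] N) : SDual Λ M ≃ₗ[Λ] SDual Λ N :=
  LinearEquiv.ofLinearMap (dualMap e.symm.toLinearMap) (dualMap e.toLinearMap)
    (by ext g x; simp) (by ext g x; simp)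

theorem dualEquiv_apply {M N : Type u} [AddCommGroup M] [Module Λ M] [AddCommGroup N]
    [Module Λ N] (e : M ≃ₗ[Λ] N) (f : SDual Λ M) (y : N) : dualEquiv e f y = f (e.symm y) := rfl

/-- Transport of a flip-isomorphism along a strong isomorphism. -/
noncomputable def FlipIso.transport {z w : SplitPreformation Λ ε} (f : StrongIso z w)
    (t : FlipIso z) : FlipIso w :=
  FlipIso.of (f.α.symm.trans (LinearEquiv.trans t.α (dualEquiv f.α)))
    (f.β.symm.trans (t.β.trans f.β)) (QGrp.map (dualMap f.α.toLinearMap) t.ν)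
    (fun x y => by
      obtain ⟨x, rfl⟩ := f.β.surjective x
      obtain ⟨y, rfl⟩ := f.α.surjective y
      have h := congrArg (fun g : SDual Λ z.F => g y) (FlipIso.apply_γ t x)
      have e : dualMap f.α.toLinearMap (w.μ (f.β x)) = z.μ x := SDual.ext fun y => f.apply_μ x y
      simp only [SDual.add_apply, SDual.units_smul_apply] at h
      simp only [LinearEquiv.trans_apply, dualEquiv_apply, toMap_map_dualMap, e, f.apply_γ,
        LinearEquiv.symm_apply_apply, f.apply_μ, LinearEquiv.coe_coe]
      exact h)
    (fun x y => by
      obtain ⟨x, rfl⟩ := f.β.surjective x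
      obtain ⟨y, rfl⟩ := f.α.surjective y
      simp only [LinearEquiv.trans_apply, dualEquiv_apply, f.apply_γ,
        LinearEquiv.symm_apply_apply, f.apply_μ]
      exact FlipIso.apply_μ t x y)
    (by
      have hθ : w.θ = QGrp.map f.β.symm.toLinearMap z.θ := f.symm.comm_θ
      have h : QGrp.map f.β.symm.toLinearMap (z.θ + QGrp.map z.μ t.ν)
          = QGrp.map f.β.symm.toLinearMap (QGrp.map t.β.toLinearMap (-z.θ)) :=
        congrArg (QGrp.map f.β.symm.toLinearMap) t.comm_θ
      have e1 : dualMap f.α.toLinearMap ∘ₗ w.μ = z.μ ∘ₗ f.β.symm.toLinearMap := by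
        refine LinearMap.ext fun x => SDual.ext fun y => ?_
        obtain ⟨x, rfl⟩ := f.β.surjective x
        show w.μ (f.β x) (f.α y) = z.μ (f.β.symm (f.β x)) y
        rw [f.apply_μ, LinearEquiv.symm_apply_apply]
      have e2 : f.β.symm.toLinearMap ∘ₗ (f.β.symm.trans (t.β.trans f.β)).toLinearMap
          = t.β.toLinearMap ∘ₗ f.β.symm.toLinearMap :=
        LinearMap.ext fun x => f.β.symm_apply_apply _
      rw [map_add, QGrp.map_map, QGrp.map_map] at h
      rw [hθ, ← map_neg, QGrp.map_map, QGrp.map_map, e1, e2]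
      exact h)

theorem asymSig_transport {z w : SplitPreformation Λ ε} (f : StrongIso z w) (t : FlipIso z) :
    asymSig w (FlipIso.transport f t) = asymSig z t := by
  have i : FlipPair.Iso ⟨z, t⟩ ⟨w, FlipIso.transport f t⟩ := .of f
    (fun x y => by
      show t.α (f.α.symm (f.α x)) (f.α.symm (f.α y)) = t.α x y
      rw [LinearEquiv.symm_apply_apply, LinearEquiv.symm_apply_apply])
    (fun x => congrArg (fun y => f.β (t.β y)) (f.β.symm_apply_apply x)) rfl
  exact (congrArg (LAsy0.proj Λ) (AsymForm.toClass_eq.2 (asymForm_iso i))).symm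

/-- The form of a hyperbolic pair is metabolic for every f.g. free L, not just for the modules Λᵏ
used to stabilize in the flip monoid. -/
theorem asymSig_sum_hypPair (a : FlipPair Λ ε) (L : Type u) [AddCommGroup L] [Module Λ L]
    [Module.Free Λ L] [Module.Finite Λ L] :
    asymSig (a.sum (hypPair Λ ε L)).z (a.sum (hypPair Λ ε L)).t = asymSig a.z a.t := by
  have h : asymSig (a.sum (hypPair Λ ε L)).z (a.sum (hypPair Λ ε L)).t
      = asymSig a.z a.t + LAsy0.mk (asymForm (hypPair Λ ε L).z (hypPair Λ ε L).t) :=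
    congrArg (LAsy0.proj Λ) (AsymForm.toClass_eq.2 (asymForm_sum a (hypPair Λ ε L)))
  rw [h, LAsy0.mk_eq_zero (asymForm_hypPair L), add_zero]

end Formations

/-! ### The induced homomorphism on the submonoid -/

section InducedMap

open SplitPreformation

variable {Λ : Type u} [Ring Λ] [StarRing Λ] {ε : ℤˣ}

theorem LMonoid.mk_sum (z w : SplitPreformation Λ ε) :
    LMonoid.mk (z.sum w) = LMonoid.mk z + LMonoid.mk w := rfl

theorem LMonoid.mk_hypBoundary (L : Type u) [AddCommGroup L] [Module Λ L] [Module.Free Λ L]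
    [Module.Finite Λ L] : LMonoid.mk (hypBoundary Λ ε L) = 0 :=
  stabMk_eq_zero (H := SplitPreformation.hyperbolic Λ ε)
    ⟨L, inferInstance, inferInstance, inferInstance, inferInstance, rfl⟩

theorem LMonoid.mk_eq_mk {z w : SplitPreformation Λ ε} :
    LMonoid.mk z = LMonoid.mk w ↔ ∃ h ∈ SplitPreformation.hyperbolic Λ ε,
      ∃ h' ∈ SplitPreformation.hyperbolic Λ ε, z.toClass + h = w.toClass + h' :=
  AddCon.eq _

theorem FLMonoid.exists_rep (x : FLMonoid Λ ε) : ∃ a : FlipPair Λ ε, FLMonoid.mk a = x := by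
  induction x using AddCon.induction_on with
  | H c =>
    obtain ⟨a, rfl⟩ := Quotient.exists_rep c
    exact ⟨a, rfl⟩

/-- The flip-isomorphism is stabilized by the standard one on the added hyperbolic boundary, then
carried over to w; neither operation changes the signature. -/
theorem exists_flipIso_of_toClass_eq (a : FlipPair Λ ε) {w : SplitPreformation Λ ε}
    {h : SplitPreformation.IsoClass Λ ε} (hh : h ∈ SplitPreformation.hyperbolic Λ ε)
    (e : a.z.toClass + h = w.toClass) : ∃ t : FlipIso w, asymSig w t = asymSig a.z a.t := by
  obtain ⟨L, _, _, _, _, rfl⟩ := hh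
  obtain ⟨f⟩ := toClass_eq.1 ((toClass_sum a.z (hypBoundary Λ ε L)).trans e)
  exact ⟨FlipIso.transport f (a.sum (hypPair Λ ε L)).t,
    (asymSig_transport f _).trans (asymSig_sum_hypPair a L)⟩

/-- Both flip-isomorphisms can be moved to a single non-singular formation, where independence of
the choice applies. -/
theorem asymSig_eq_of_mk_eq {a b : FlipPair Λ ε} {z : SplitPreformation Λ ε}
    (hz : z.IsNonsingularFormation) (ha : LMonoid.mk a.z = LMonoid.mk z)
    (hb : LMonoid.mk b.z = LMonoid.mk z) : asymSig a.z a.t = asymSig b.z b.t := by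
  obtain ⟨h, hh, k, hk, e⟩ := LMonoid.mk_eq_mk.1 ha
  obtain ⟨h', hh', k', hk', e'⟩ := LMonoid.mk_eq_mk.1 hb
  -- The two stable equalities end in z + k and z + k'. Adding k' to the first and k to the second
  -- gives the common target z + (k + k').
  obtain ⟨L, _, _, _, _, hL⟩ := add_mem hk hk'
  have hw := hz.sum (hypBoundary_isNonsingularFormation (Λ := Λ) (ε := ε) L)
  have hc : (z.sum (hypBoundary Λ ε L)).toClass = z.toClass + (k + k') := by
    rw [toClass_sum, hL]
  obtain ⟨t, ht⟩ := exists_flipIso_of_toClass_eq a (add_mem hh hk')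
    (w := z.sum (hypBoundary Λ ε L)) (by rw [hc, ← add_assoc, e, add_assoc])
  obtain ⟨t', ht'⟩ := exists_flipIso_of_toClass_eq b (add_mem hh' hk)
    (w := z.sum (hypBoundary Λ ε L)) (by rw [hc, ← add_assoc, e', add_assoc, add_comm k'])
  rw [← ht, ← ht', asymSig_eq_of_isNonsingularFormation hw t t']

theorem asymSigHom_eq_of_π_eq {x y : FLMonoid Λ ε} (hx : FLMonoid.π Λ ε x ∈ lTilde Λ ε)
    (h : FLMonoid.π Λ ε x = FLMonoid.π Λ ε y) : asymSigHom Λ ε x = asymSigHom Λ ε y := by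
  obtain ⟨z, hz, e, -⟩ := hx
  obtain ⟨a, rfl⟩ := FLMonoid.exists_rep x
  obtain ⟨b, rfl⟩ := FLMonoid.exists_rep y
  exact asymSig_eq_of_mk_eq hz e (h.symm.trans e)

/-- A stable flip-isomorphism of z is a flip-isomorphism of z + h, and z + h has the same class as
z. -/
theorem exists_π_eq {a : LMonoid Λ ε} (ha : a ∈ lTilde Λ ε) : ∃ x, FLMonoid.π Λ ε x = a := by
  obtain ⟨z, -, rfl, L, _, _, _, _, ⟨t⟩⟩ := ha
  refine ⟨FLMonoid.mk ⟨z.sum (hypBoundary Λ ε L), t⟩, ?_⟩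
  rw [FLMonoid.π_mk, LMonoid.mk_sum, LMonoid.mk_hypBoundary, add_zero]

/-- The submonoid `l̃_{2q+2}(Λ)` of `l_{2q+2}(Λ)`. -/
noncomputable def lTildeSubmonoid (Λ : Type u) [Ring Λ] [StarRing Λ] (ε : ℤˣ) :
    AddSubmonoid (LMonoid Λ ε) where
  carrier := lTilde Λ ε
  zero_mem' := ⟨hypBoundary Λ ε PUnit.{u + 1}, hypBoundary_isNonsingularFormation _,
    (LMonoid.mk_hypBoundary _).symm, PUnit.{u + 1}, inferInstance, inferInstance, inferInstance,
    inferInstance, ⟨FlipIso.sum (hypPair Λ ε _).t (hypPair Λ ε _).t⟩⟩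
  add_mem' := by
    rintro _ _ ⟨z, hz, rfl, L, _, _, _, _, ⟨t⟩⟩ ⟨w, hw, rfl, L', _, _, _, _, ⟨s⟩⟩
    -- The hyperbolic boundaries are moved to the end and merged, so that the sum of the
    -- flip-isomorphisms becomes a stable one of z + w.
    have e : ((z.sum (hypBoundary Λ ε L)).sum (w.sum (hypBoundary Λ ε L'))).toClass
        = ((z.sum w).sum (hypBoundary Λ ε (L × L'))).toClass := by
      have e' : (hypBoundary Λ ε (L × L')).toClass
          = (hypBoundary Λ ε L).toClass + (hypBoundary Λ ε L').toClass :=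
        (toClass_eq.2 ⟨(hypPairSumIso (LinearEquiv.refl Λ (L × L'))).toStrong⟩).symm
      rw [toClass_sum, toClass_sum, toClass_sum, toClass_sum, toClass_sum, e', add_add_add_comm]
    obtain ⟨f⟩ := toClass_eq.1 e
    exact ⟨z.sum w, hz.sum hw, (LMonoid.mk_sum z w).symm, L × L', inferInstance, inferInstance,
      inferInstance, inferInstance, ⟨FlipIso.transport f (FlipIso.sum t s)⟩⟩

/-- The map which the asymmetric signature induces on `l̃_{2q+2}(Λ)`. -/
noncomputable def lTildeSig (Λ : Type u) [Ring Λ] [StarRing Λ] (ε : ℤˣ) :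
    lTildeSubmonoid Λ ε →+ LAsy0 Λ where
  -- An arbitrary lift to the flip monoid; `asymSigHom_eq_of_π_eq` makes the value independent of
  -- it, whence additivity.
  toFun a := asymSigHom Λ ε (exists_π_eq a.2).choose
  map_zero' := by
    have h := (exists_π_eq (0 : lTildeSubmonoid Λ ε).2).choose_spec
    rw [← (asymSigHom Λ ε).map_zero]
    refine asymSigHom_eq_of_π_eq ?_ (h.trans (map_zero _).symm)
    rw [h]
    exact (0 : lTildeSubmonoid Λ ε).2
  map_add' a b := by
    have h := (exists_π_eq (a + b).2).choose_spec
    rw [← map_add]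
    refine asymSigHom_eq_of_π_eq ?_ (h.trans ?_)
    · rw [h]
      exact (a + b).2
    · rw [map_add, (exists_π_eq a.2).choose_spec, (exists_π_eq b.2).choose_spec]
      rfl

theorem lTildeSig_π (x : FLMonoid Λ ε) (hx : FLMonoid.π Λ ε x ∈ lTildeSubmonoid Λ ε) :
    lTildeSig Λ ε ⟨FLMonoid.π Λ ε x, hx⟩ = asymSigHom Λ ε x := by
  have h := (exists_π_eq hx).choose_spec
  refine asymSigHom_eq_of_π_eq ?_ h
  rw [h]
  exact hx

end InducedMap

end Preform

theorem mainTheorem9 {Λ : Type*} [Ring Λ] [StarRing Λ] [IsStablyFiniteRing Λ] (q : ℕ) (hq : 2 ≤ q) :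
    (∀ z : Preform.SplitPreformation Λ ((-1) ^ q), z.IsNonsingularFormation →
      ∀ t t' : z.FlipIso, Preform.asymSig z t = Preform.asymSig z t') ∧
    ∃ S : AddSubmonoid (Preform.LMonoid Λ ((-1) ^ q)),
      (S : Set (Preform.LMonoid Λ ((-1) ^ q))) = Preform.lTilde Λ ((-1) ^ q) ∧
      ∃! s : S →+ Preform.LAsy0 Λ, ∀ (x : Preform.FLMonoid Λ ((-1) ^ q))
        (hx : Preform.FLMonoid.π Λ ((-1) ^ q) x ∈ S),
        s ⟨Preform.FLMonoid.π Λ ((-1) ^ q) x, hx⟩ = Preform.asymSigHom Λ ((-1) ^ q) x := by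
  refine ⟨fun z hz t t' => Preform.asymSig_eq_of_isNonsingularFormation hz t t',
    Preform.lTildeSubmonoid Λ ((-1) ^ q), rfl, Preform.lTildeSig Λ ((-1) ^ q),
    Preform.lTildeSig_π, fun s hs => ?_⟩
  ext ⟨a, ha⟩
  -- Uniqueness: every element of the submonoid is some π(x), where the value is prescribed.
  obtain ⟨x, rfl⟩ := Preform.exists_π_eq ha
  rw [hs, Preform.lTildeSig_π]
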